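/- Let $X_1,X_2,\dots$ be real random variables on a probability space, let $S_N=X_1+\dots+X_N$, and suppose that there are a complex Banach space $\mathcal B$, bounded linear operators $\mathcal L_t:\mathcal B\to\mathcal B$ $(t\in\mathbb R)$, a vector $v\in\mathcal B$ and a functional $\ell\in\mathcal B'$ with $$\mathbb E\big(e^{itS_N}\big)=\ell(\mathcal L_t^N v)\qquad\text{for all } t\in\mathbb R,\ N\ge 1 .$$ Let $r\ge 0$ be an integer and assume the following. - (A1) $t\mapsto\mathcal L_t$ is continuous in operator norm, and there is $\delta>0$ such that it is $r+2$ times continuously differentiable for $|t|\le\delta$. - (A2) $1$ is an isolated point of the spectrum and an (algebraically) simple eigenvalue of $\mathcal L_0$, all other eigenvalues of $\mathcal L_0$ have modulus less than $1$, and the essential spectrum of $\mathcal L_0$ (the $z$ for which $\mathcal L_0-z$ is not Fredholm) is contained in a disk $\{|z|\le\rho\}$ with $\rho<1$. - (A3) For all $t\ne 0$, the spectrum of $\mathcal L_t$ is contained in $\{|z|<1\}$. - (A4) There are positive real numbers $K,r_1,r_2,N_0$ such that $\|\mathcal L_t^N\|\le N^{-r_2}$ whenever $N>N_0$ and $K\le|t|\le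 N^{r_1}$. - Non-degeneracy: the variance of the limiting normal law of $S_N$ is positive, that is, whenever $A\in\mathbb R$ and $\sigma^2\ge 0$ are such that $(S_N-NA)/\sqrt N$ converges in distribution to $\mathcal N(0,\sigma^2)$, then $\sigma^2>0$. For integers $m,k\ge0$ put $$C^m_k(f)=\max_{0\le j\le m}\|f^{(j)}\|_{L^1(\mathbb R)}+\max_{0\le j\le k}\|x^jf\|_{L^1(\mathbb R)},$$ and let $F^m_k$ be the set of $m$ times continuously differentiable $f:\mathbb R\to\mathbb C$ with $C^m_k(f)<\infty$. Let $q\in\mathbb N$ satisfy $q>\frac{r+1}{2r_1}$. Then $S_N$ admits the weak local Edgeworth expansion of order $r$ for $f\in F^{q+2}_{r+1}$. That is, there are $A\in\mathbb R$ and $\sigma^2>0$ such that $(S_N-NA)/\sqrt N$ converges in distribution to $\mathcal N(0,\sigma^2)$, and, for this $A$, there are real polynomials $P_{p,l}$ $(0\le p\le\lfloor r/2\rfloor)$ and a sequence $\varepsilon_N=o(N^{-r/2})$, all independent of $f$, such that for every $f\in F^{q+2}_{r+1}$ and every $N\ge1$ the integrals below converge absolutely and $$\left|\sqrt N\,\mathbb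 E\big(f(S_N-NA)\big)-\frac1{2\pi}\sum_{p=0}^{\lfloor r/2\rfloor}\frac1{N^p}\int_{\mathbb R}P_{p,l}(z)f(z)\,dz\right|\le C^{q+2}_{r+1}(f)\,\varepsilon_N .$$ -/

import Mathlib

open MeasureTheory ProbabilityTheory Filter Topology Asymptotics
open scoped NNReal ENNReal

namespace Edgeworth

section Operators

variable {B : Type*} [NormedAddCommGroup B] [NormedSpace ℂ B]

/-- The essential spectrum of a bounded operator: the `z` for which `T - z` is not Fredholm. -/
def essentialSpectrum (T : B →L[ℂ] B) : Set ℂ :=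
  {z : ℂ | ¬ ContinuousLinearMap.IsFredholm (T - z • ContinuousLinearMap.id ℂ B)}

/-- (A1), with the order of differentiability `s` explicit: `t ↦ L t` is continuous (in operator
norm) on `ℝ` and `s` times continuously differentiable on some interval `[-δ, δ]`. -/
def AssumptionA1 (L : ℝ → B →L[ℂ] B) (s : ℕ) : Prop :=
  Continuous L ∧ ∃ δ : ℝ, 0 < δ ∧ ContDiffOn ℝ s L (Set.Icc (-δ) δ)

/-- (A2), for the operator `T = L 0`: `1` is an isolated point of the spectrum and an eigenvalue of
algebraic multiplicity one, all other eigenvalues have modulus less than one, and the essential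
spectrum lies in a closed disk of radius `ρ < 1`. -/
def AssumptionA2 (T : B →L[ℂ] B) : Prop :=
  ¬ AccPt (1 : ℂ) (𝓟 (spectrum ℂ T)) ∧
  Module.finrank ℂ (Module.End.maxGenEigenspace (T : B →ₗ[ℂ] B) 1) = 1 ∧
  (∀ z : ℂ, Module.End.HasEigenvalue (T : B →ₗ[ℂ] B) z → z ≠ 1 → ‖z‖ < 1) ∧
  ∃ ρ : ℝ, ρ < 1 ∧ essentialSpectrum T ⊆ Metric.closedBall 0 ρ

/-- (A3): for `t ≠ 0` the spectrum of `L t` lies in the open unit disk. -/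
def AssumptionA3 (L : ℝ → B →L[ℂ] B) : Prop :=
  ∀ t : ℝ, t ≠ 0 → spectrum ℂ (L t) ⊆ Metric.ball 0 1

/-- (A4), with the exponent `r₁` explicit. -/
def AssumptionA4 (L : ℝ → B →L[ℂ] B) (r₁ : ℝ) : Prop :=
  0 < r₁ ∧ ∃ K r₂ N₀ : ℝ, 0 < K ∧ 0 < r₂ ∧ 0 < N₀ ∧
    ∀ (N : ℕ) (t : ℝ), N₀ < N → K ≤ |t| → |t| ≤ (N : ℝ) ^ r₁ →
      ‖(L t) ^ N‖ ≤ 1 / (N : ℝ) ^ r₂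

end Operators

section FunctionSpace

/-- `C^m(f) = max_{j ≤ m} ‖f^{(j)}‖_{L¹}`. -/
noncomputable def derivNorm (m : ℕ) (f : ℝ → ℂ) : ℝ≥0∞ :=
  (Finset.range (m + 1)).sup fun j => eLpNorm (iteratedDeriv j f) 1 volume

/-- `C_k(f) = max_{j ≤ k} ‖x^j f‖_{L¹}`. -/
noncomputable def momentNorm (k : ℕ) (f : ℝ → ℂ) : ℝ≥0∞ :=
  (Finset.range (k + 1)).sup fun j => eLpNorm (fun x : ℝ => (x : ℂ) ^ j * f x) 1 volume

/-- `C^m_k(f) = C^m(f) + C_k(f)`. -/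
noncomputable def mixedNorm (m k : ℕ) (f : ℝ → ℂ) : ℝ≥0∞ :=
  derivNorm m f + momentNorm k f

/-- The space `F^m_k`: the `m` times continuously differentiable `f` with `C^m_k(f) < ∞`. -/
def functionSpace (m k : ℕ) : Set (ℝ → ℂ) :=
  {f | ContDiff ℝ m f ∧ mixedNorm m k f < ∞}

end FunctionSpace

section Expansions

variable {Ω : Type*} [MeasurableSpace Ω]

/-- `S_N = X_1 + ⋯ + X_N`. -/
def partialSum (X : ℕ → Ω → ℝ) (N : ℕ) (ω : Ω) : ℝ :=
  ∑ n ∈ Finset.Icc 1 N, X n ω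

/-- `(S_N - N A) / √N` converges in distribution to the (possibly degenerate) normal law with mean
`0` and variance `v`. -/
def NormalLimit (P : Measure Ω) [IsProbabilityMeasure P] (S : ℕ → Ω → ℝ) (A : ℝ) (v : ℝ≥0) :
    Prop :=
  TendstoInDistribution (fun (N : ℕ) (ω : Ω) => (S N ω - N * A) / √(N : ℝ)) atTop
    (fun x : ℝ => x) (fun _ => P) (gaussianReal 0 v)

/-- `S_N` admits the weak local Edgeworth expansion of order `r`, with centering constant `A`, for
the functions in the class `𝓕` with norm `nrm`.  The polynomials `p ↦ Q p` and the error rate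
`ε N = o(N ^ (-r/2))` do not depend on `f`; all the integrals involved converge. -/
def WeakLocalEdgeworth (P : Measure Ω) (S : ℕ → Ω → ℝ) (A : ℝ) (r : ℕ)
    (𝓕 : Set (ℝ → ℂ)) (nrm : (ℝ → ℂ) → ℝ) : Prop :=
  ∃ (Q : ℕ → Polynomial ℝ) (ε : ℕ → ℝ),
    (ε =o[atTop] fun N : ℕ => (N : ℝ) ^ (-(r : ℝ) / 2)) ∧
    ∀ f ∈ 𝓕,
      (∀ p ≤ r / 2, Integrable (fun z : ℝ => (((Q p).eval z : ℝ) : ℂ) * f z)) ∧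
      ∀ N : ℕ, 1 ≤ N →
        Integrable (fun ω => f (S N ω - N * A)) P ∧
        ‖((√(N : ℝ) : ℝ) : ℂ) * (∫ ω, f (S N ω - N * A) ∂P)
          - 1 / (2 * (Real.pi : ℂ)) * ∑ p ∈ Finset.range (r / 2 + 1),
              1 / (N : ℂ) ^ p * ∫ z : ℝ, (((Q p).eval z : ℝ) : ℂ) * f z‖
          ≤ nrm f * ε N

end Expansions

end Edgeworth

/-! Fourier inversion writes `E f(S_N - N A)` as `(2π)⁻¹ ∫ f̂(t) φ_N(t) dt`, where `φ_N` is the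
characteristic function of the centred sum and `|φ_N(t)| = |l(L_t^N v)|`. The size of `φ_N` is
controlled on separate frequency ranges.

For `|t| ≤ δ` the simple eigenvalue `1` of `L 0` continues to an eigenvalue `lam t` of class
`C^(r+2)`, while the rest of the spectrum stays inside a smaller disk (`exists_leading_eigenvalue`).
Taking the logarithm, `φ_N(t) = Z(t) exp(N(-c t² + ψ(t)))` up to an exponentially small error, with
`ψ` negligible against `t²` (`exists_local_form`). The linear term of `log lam` is purely imaginary
because `|lam| ≤ 1`, and it is removed by the centring `A`. The quadratic coefficient is real and
nonpositive because the rescaled characteristic functions converge, and nonzero by non-degeneracy.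
Laplace's method with `t = s / √N` then expands the integrals of `t^k φ_N` (`hasExpansion_laplace`).
Odd powers of `1 / √N` come with odd Gaussian moments, which vanish, so only powers of `1 / N`
remain.

In this range `f̂` is replaced by its Taylor polynomial of degree `r`, whose coefficients are
moments of `f`. Hence `f` enters the main terms only through integrals against polynomials that do
not depend on `f`, and the error is a multiple of the norm of `f`
(`weakLocalEdgeworth_of_expansion`).

For `|t| ≥ δ` everything is `o(N^(-(r+1)/2))` (`exists_high_frequency_bound`). On `δ ≤ |t| ≤ K`,
(A3) and compactness give exponential decay. On `K ≤ |t| ≤ N^(θ r₁)` with `θ < 1`, (A4) applied to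
many blocks of length about `N^θ` gives decay faster than any power. Beyond that, the derivatives of
`f` make `f̂` gain a factor `N^(-θ r₁ q)`, and `θ` can be chosen with `θ r₁ q > (r+1)/2` exactly
because `q > (r+1)/(2 r₁)`. -/

namespace Edgeworth

/-! ### Spectral gap of the unperturbed operator. -/

section SpectralGap

variable {B : Type*} [NormedAddCommGroup B] [NormedSpace ℂ B] [CompleteSpace B]

/-- The range is closed, so density suffices. Solutions of `A x - ε x = y` satisfy `‖x‖ ≤ 2 K ‖y‖`
once `K ‖ε‖ < 1/2`, hence `A x = y + ε x` tends to `y` as `ε → 0`. -/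
theorem surjective_of_antilipschitz_of_frequently {A : B →L[ℂ] B} {K : ℝ≥0}
    (hA : AntilipschitzWith K A)
    (h : ∃ᶠ ε in 𝓝 (0 : ℂ), Function.Surjective fun x => A x - ε • x) :
    Function.Surjective A := by
  have hcl : IsClosed (Set.range A) := hA.isClosed_range A.uniformContinuous
  intro y
  suffices y ∈ closure (Set.range A) by rwa [hcl.closure_eq] at this
  rw [Metric.mem_closure_iff]
  intro η hη
  have hev : ∀ᶠ ε in 𝓝 (0 : ℂ), (K : ℝ) * ‖ε‖ < 1 / 2 ∧ ‖ε‖ * (2 * K * ‖y‖) < η := by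
    have h1 : Tendsto (fun ε : ℂ => (K : ℝ) * ‖ε‖) (𝓝 0) (𝓝 0) := by
      have : Continuous (fun ε : ℂ => (K : ℝ) * ‖ε‖) := by fun_prop
      simpa using this.tendsto 0
    have h2 : Tendsto (fun ε : ℂ => ‖ε‖ * (2 * K * ‖y‖)) (𝓝 0) (𝓝 0) := by
      have : Continuous (fun ε : ℂ => ‖ε‖ * (2 * K * ‖y‖)) := by fun_prop
      simpa using this.tendsto 0
    exact (h1.eventually (gt_mem_nhds (by norm_num))).and (h2.eventually (gt_mem_nhds hη))
  obtain ⟨ε, hs, hε1, hε2⟩ := (h.and_eventually hev).exists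
  obtain ⟨x, hx⟩ := hs y
  refine ⟨A x, ⟨x, rfl⟩, ?_⟩
  have hAx : A x = y + ε • x := by rw [← hx]; simp
  have hb : ‖x‖ ≤ K * ‖A x‖ := by simpa using hA.le_mul_dist x 0
  have hn : ‖A x‖ ≤ ‖y‖ + ‖ε‖ * ‖x‖ := by
    rw [hAx]; exact (norm_add_le _ _).trans (by rw [norm_smul])
  have hx2 : ‖x‖ ≤ 2 * K * ‖y‖ := by
    have : (K : ℝ) * ‖A x‖ ≤ K * (‖y‖ + ‖ε‖ * ‖x‖) := by gcongr
    nlinarith [norm_nonneg x, mul_le_mul_of_nonneg_right hε1.le (norm_nonneg x)]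
  rw [dist_eq_norm, hAx]
  simp only [sub_add_cancel_left, norm_neg, norm_smul]
  exact lt_of_le_of_lt (by gcongr) hε2

theorem bijective_sub_smul_of_notMem_spectrum {T : B →L[ℂ] B} {z : ℂ} (hz : z ∉ spectrum ℂ T) :
    Function.Bijective fun x => T x - z • x := by
  rw [spectrum.notMem_iff] at hz
  have := ContinuousLinearMap.isUnit_iff_bijective.1 hz.neg
  convert this using 2 with x
  simp [Algebra.algebraMap_eq_smul_one]

theorem notMem_spectrum_of_bijective {T : B →L[ℂ] B} {z : ℂ}
    (h : Function.Bijective fun x => T x - z • x) : z ∉ spectrum ℂ T := by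
  rw [spectrum.notMem_iff, ← IsUnit.neg_iff]
  refine ContinuousLinearMap.isUnit_iff_bijective.2 ?_
  convert h using 2 with x
  simp [Algebra.algebraMap_eq_smul_one]

theorem antilipschitz_of_isFredholm {S : B →L[ℂ] B} (hS : S.IsFredholm)
    (hinj : Function.Injective S) : ∃ K, AntilipschitzWith K S :=
  S.antilipschitz_of_injective_of_isClosed_range hinj hS.isClosed_range

/-- A point of the spectrum that is a limit of points of the resolvent set and at which the operator
is Fredholm is an eigenvalue. -/
theorem hasEigenvalue_of_frequently_notMem_spectrum {T : B →L[ℂ] B} {z : ℂ}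
    (hz : z ∈ spectrum ℂ T) (hfr : ∃ᶠ w in 𝓝 z, w ∉ spectrum ℂ T)
    (hF : z ∉ essentialSpectrum T) :
    Module.End.HasEigenvalue (T : B →ₗ[ℂ] B) z := by
  -- Without an eigenvector, `T - z` is injective with closed range, hence bounded below. Nearby
  -- resolvent points then make it surjective, so `z` would not be in the spectrum.
  by_contra hne
  have hF' : (T - z • ContinuousLinearMap.id ℂ B).IsFredholm := not_not.1 hF
  have hinj : Function.Injective (T - z • ContinuousLinearMap.id ℂ B) := by
    rw [injective_iff_map_eq_zero]
    intro x hx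
    by_contra hx0
    refine hne (Module.End.hasEigenvalue_of_hasEigenvector (x := x) ⟨?_, hx0⟩)
    rw [Module.End.mem_eigenspace_iff]
    simpa [sub_eq_zero] using hx
  obtain ⟨K, hK⟩ := antilipschitz_of_isFredholm hF' hinj
  have hsurj := surjective_of_antilipschitz_of_frequently hK (by
    have ht : Tendsto (fun w : ℂ => w - z) (𝓝 z) (𝓝 0) := by
      have : Continuous fun w : ℂ => w - z := by fun_prop
      simpa using this.tendsto z
    refine ht.frequently (hfr.mono fun w hw => ?_)
    convert (bijective_sub_smul_of_notMem_spectrum hw).2 using 2 with x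
    simp [sub_smul])
  refine notMem_spectrum_of_bijective (T := T) (z := z) ?_ hz
  exact (⟨hinj, hsurj⟩ : Function.Bijective (T - z • ContinuousLinearMap.id ℂ B))

/-- Such a `z` is a boundary point of the spectrum, since the points `(1 + s) z` with `s > 0` lie
outside it. It is also outside the disk of radius `ρ`, so it is an eigenvalue, and (A2) leaves only
`1`. -/
theorem eq_one_of_norm_maximal {T : B →L[ℂ] B} (hT : AssumptionA2 T) {z : ℂ}
    (hz : z ∈ spectrum ℂ T) (h1 : 1 ≤ ‖z‖) (hmax : ∀ w ∈ spectrum ℂ T, ‖w‖ ≤ ‖z‖) : z = 1 := by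
  obtain ⟨-, -, hev, ρ, hρ, hess⟩ := hT
  by_contra hne
  refine absurd (hev z (hasEigenvalue_of_frequently_notMem_spectrum hz ?_ ?_) hne) (not_lt.2 h1)
  · have ht : Tendsto (fun s : ℝ => ((1 + s : ℝ) : ℂ) * z) (𝓝[>] 0) (𝓝 z) := by
      have : Continuous fun s : ℝ => ((1 + s : ℝ) : ℂ) * z := by fun_prop
      simpa using (this.tendsto 0).mono_left nhdsWithin_le_nhds
    refine ht.frequently (Eventually.frequently ?_)
    filter_upwards [self_mem_nhdsWithin] with s hs hmem
    have h := hmax _ hmem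
    have hs' : (0 : ℝ) < s := hs
    rw [norm_mul, Complex.norm_real, Real.norm_of_nonneg (by linarith)] at h
    nlinarith
  · intro hmem
    have := hess hmem
    rw [mem_closedBall_zero_iff] at this
    linarith

/-- (A2) bounds only the eigenvalues; this extends the bound to the spectrum. If some `‖z‖ ≥ 1`, a
spectral point of maximal modulus exists by compactness and must be `1`; then `z` is itself of
maximal modulus. -/
theorem norm_lt_one_of_mem_spectrum {T : B →L[ℂ] B} (hT : AssumptionA2 T) {z : ℂ}
    (hz : z ∈ spectrum ℂ T) (hne : z ≠ 1) : ‖z‖ < 1 := by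
  by_contra! h
  obtain ⟨w, hw, hmax⟩ := (spectrum.isCompact T).exists_isMaxOn ⟨z, hz⟩
    (continuous_norm.continuousOn)
  have hmax' : ∀ x ∈ spectrum ℂ T, ‖x‖ ≤ ‖w‖ := fun x hx => hmax hx
  have hw1 := eq_one_of_norm_maximal hT hw (h.trans (hmax' z hz)) hmax'
  refine hne (eq_one_of_norm_maximal hT hz h fun x hx => (hmax' x hx).trans ?_)
  simpa [hw1] using h

/-- The spectral projection onto the leading eigenspace, in coordinates `x ↦ ξ x • e`, and the
resulting spectral gap. -/
theorem exists_leading_eigenpair {T : B →L[ℂ] B} (hT : AssumptionA2 T) :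
    ∃ (e : B) (ξ : B →L[ℂ] ℂ), ξ e = 1 ∧ T e = e ∧ ξ ∘L T = ξ ∧
      spectrum ℂ (T - ξ.smulRight e) ⊆ Metric.ball 0 1 := by
  have hspec := fun z => norm_lt_one_of_mem_spectrum hT (z := z)
  obtain ⟨hiso, hrank, -, ρ, hρ, hess⟩ := hT
  set S : B →L[ℂ] B := T - (1 : ℂ) • ContinuousLinearMap.id ℂ B with hS
  have hSapp : ∀ x, S x = T x - x := fun x => by simp [hS]
  have hFred : S.IsFredholm := by
    by_contra h
    have : (1 : ℂ) ∈ essentialSpectrum T := h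
    have := hess this
    rw [mem_closedBall_zero_iff, norm_one] at this
    linarith
  have hmem : ∀ (k : ℕ) (x : B), (S ^ k) x = 0 →
      x ∈ Module.End.maxGenEigenspace (T : B →ₗ[ℂ] B) 1 := by
    intro k x hx
    rw [Module.End.mem_maxGenEigenspace]
    refine ⟨k, ?_⟩
    have : ((T : B →ₗ[ℂ] B) - (1 : ℂ) • (1 : Module.End ℂ B)) = (S : B →ₗ[ℂ] B) := by
      ext y; simp [hS]
    rw [this, ← hx]
    exact congrArg (fun f : B →ₗ[ℂ] B => f x) (ContinuousLinearMap.toLinearMap_pow S k).symm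
  set G := Module.End.maxGenEigenspace (T : B →ₗ[ℂ] B) 1 with hG
  -- A nonzero generalised eigenvector gives a genuine one: its last nonzero image under the powers
  -- of `S`.
  obtain ⟨u, hu0, huS⟩ : ∃ u : B, u ≠ 0 ∧ S u = 0 := by
    have : Nontrivial G := Module.nontrivial_of_finrank_pos (R := ℂ) (by rw [hrank]; exact one_pos)
    obtain ⟨⟨x, hx⟩, hx0⟩ := exists_ne (0 : G)
    have hx0' : x ≠ 0 := fun h => hx0 (Subtype.ext h)
    have hex : ∃ k : ℕ, (S ^ k) x = 0 := by
      obtain ⟨k, hk⟩ := (Module.End.mem_maxGenEigenspace _ _ _).1 hx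
      refine ⟨k, ?_⟩
      have : ((T : B →ₗ[ℂ] B) - (1 : ℂ) • (1 : Module.End ℂ B)) = (S : B →ₗ[ℂ] B) := by
        ext y; simp [hS]
      rw [this] at hk
      rw [← hk]
      exact congrArg (fun f : B →ₗ[ℂ] B => f x) (ContinuousLinearMap.toLinearMap_pow S k)
    classical
    have hk := Nat.find_spec hex
    obtain ⟨j, hj⟩ : ∃ j, Nat.find hex = j + 1 := by
      refine Nat.exists_eq_succ_of_ne_zero fun h0 => hx0' ?_
      rw [h0] at hk
      simpa using hk
    refine ⟨(S ^ j) x, fun h => Nat.find_min hex (by omega) h, ?_⟩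
    rw [hj, pow_succ'] at hk
    exact hk
  have hspan : ∀ x ∈ G, ∃ c : ℂ, c • u = x := by
    intro x hx
    have huG : u ∈ G := hmem 1 u (by simpa using huS)
    obtain ⟨c, hc⟩ := (finrank_eq_one_iff_of_nonzero' (⟨u, huG⟩ : G)
      (fun h => hu0 (congrArg Subtype.val h))).1 hrank ⟨x, hx⟩
    exact ⟨c, congrArg Subtype.val hc⟩
  have hker : ∀ x, S x = 0 → ∃ c : ℂ, c • u = x := fun x hx =>
    hspan x (hmem 1 x (by simpa using hx))
  -- Algebraic simplicity: the kernels of `S` and of `S²` are both the line through `u`, so kernel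
  -- and range of `S` meet only in `0`.
  have hker2 : ∀ x, S (S x) = 0 → S x = 0 := by
    intro x hx
    obtain ⟨c, rfl⟩ := hspan x (hmem 2 x (by rw [pow_two]; exact hx))
    simp [huS]
  -- the restriction of `S` to its range
  have hcof := hFred.finite_coker
  have hFcl : IsClosed (S.range : Set B) := hFred.isClosed_range
  have hcomp : CompleteSpace S.range := hFcl.completeSpace_coe
  have hmaps : ∀ x ∈ S.range, S x ∈ S.range := fun x _ => ⟨x, rfl⟩
  set R : S.range →L[ℂ] S.range := S.restrict hmaps with hR
  have hRapp : ∀ x, (R x : B) = S x := fun x => rfl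
  have hRinj : Function.Injective R := by
    rw [injective_iff_map_eq_zero]
    rintro ⟨x, y, rfl⟩ hx
    exact Subtype.ext (hker2 y (congrArg Subtype.val hx))
  obtain ⟨K, hK⟩ : ∃ K, AntilipschitzWith K R := by
    have h1 := (S.isStrictMap_isClosed_range_iff_restrict S.range hFcl).1
      ⟨hFred.isStrictMap, hFcl⟩
    have hinj : Function.Injective (S.domRestrict S.range) := fun x y hxy =>
      hRinj (Subtype.ext hxy)
    obtain ⟨K, hK⟩ := (S.domRestrict S.range).antilipschitz_of_injective_of_isClosed_range
      hinj h1.2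
    exact ⟨K, fun x y => hK x y⟩
  -- This is where isolation of `1` is used: `R - ε` is surjective for suitable arbitrarily small `ε
  -- ≠ 0`. The preimage under `T - w` of a vector `y` in the range of `S` stays in that range,
  -- because `(w - 1) x = S x - y`.
  have hRsurj : Function.Surjective R := by
    refine surjective_of_antilipschitz_of_frequently hK ?_
    have hfr : ∃ᶠ z in 𝓝[≠] (1 : ℂ), z ∉ spectrum ℂ T := by
      rw [accPt_iff_frequently_nhdsNE, not_frequently] at hiso
      exact hiso.frequently
    have ht : Tendsto (fun w : ℂ => w - 1) (𝓝[≠] 1) (𝓝[≠] 0) := by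
      refine tendsto_nhdsWithin_iff.2 ⟨?_, ?_⟩
      · have : Continuous fun w : ℂ => w - 1 := by fun_prop
        simpa using (this.tendsto 1).mono_left nhdsWithin_le_nhds
      · filter_upwards [self_mem_nhdsWithin] with w hw
        exact sub_ne_zero.2 hw
    have h2 : ∃ᶠ ε in 𝓝[≠] (0 : ℂ), Function.Surjective fun x => R x - ε • x := by
      refine (ht.frequently ((hfr.and_eventually self_mem_nhdsWithin).mono ?_))
      rintro w ⟨hw, hw1⟩ ⟨y, hy⟩
      obtain ⟨x, hx⟩ := (bijective_sub_smul_of_notMem_spectrum hw).2 y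
      have hx' : S x - (w - 1) • x = y := by
        rw [← show T x - w • x = y from hx, hSapp, sub_smul, one_smul]; abel
      have hw0 : w - 1 ≠ 0 := sub_ne_zero.2 hw1
      have hxF : x ∈ S.range := by
        have : x = (w - 1)⁻¹ • (S x - y) := by
          rw [← hx', sub_sub_cancel, smul_smul, inv_mul_cancel₀ hw0, one_smul]
        rw [this]
        exact Submodule.smul_mem _ _ (Submodule.sub_mem _ ⟨x, rfl⟩ hy)
      exact ⟨⟨x, hxF⟩, Subtype.ext hx'⟩
    exact h2.filter_mono nhdsWithin_le_nhds
  -- The space is the direct sum of the line through `u` and the range of `S`.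
  have hdecomp : ∀ x, ∃ (c : ℂ) (y : B), x = c • u + S y := by
    intro x
    obtain ⟨⟨_, y, rfl⟩, hy⟩ := hRsurj ⟨S x, x, rfl⟩
    have hy' : S (S y) = S x := congrArg Subtype.val hy
    obtain ⟨c, hc⟩ := hker (x - S y) (by rw [map_sub, hy', sub_self])
    exact ⟨c, y, by rw [hc]; abel⟩
  have huF : u ∉ S.range := by
    rintro ⟨y, hy⟩
    have hy' : S y = u := hy
    exact hu0 (by rw [← hy', hker2 y (by rw [hy', huS])])
  -- Hahn–Banach on the quotient by the closed range of `S` makes the projection continuous.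
  obtain ⟨g, hgu, hgS⟩ : ∃ g : B →L[ℂ] ℂ, g u ≠ 0 ∧ ∀ x, g (S x) = 0 := by
    have : IsClosed (S.range : Set B) := hFcl
    have hne : ‖S.range.mkQL u‖ ≠ 0 := by
      rw [norm_ne_zero_iff]
      simpa [Submodule.Quotient.mk_eq_zero] using huF
    obtain ⟨g, -, hg⟩ := exists_dual_vector ℂ (S.range.mkQL u) hne
    refine ⟨g ∘L S.range.mkQL, ?_, fun x => ?_⟩
    · simp only [ContinuousLinearMap.comp_apply]
      rw [hg]
      exact Complex.ofReal_ne_zero.2 hne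
    · have : S.range.mkQL (S x) = 0 := by
        rw [Submodule.mkQL_apply, Submodule.mkQ_apply, Submodule.Quotient.mk_eq_zero]
        exact ⟨x, rfl⟩
      rw [ContinuousLinearMap.comp_apply, this, map_zero]
  set ξ : B →L[ℂ] ℂ := (g u)⁻¹ • g with hξ
  have hξu : ξ u = 1 := by simp [hξ, hgu]
  have hξS : ∀ x, ξ (S x) = 0 := fun x => by simp [hξ, hgS]
  have hTu : T u = u := by rw [← sub_eq_zero, ← hSapp, huS]
  have hξT : ∀ x, ξ (T x) = ξ x := fun x => by
    rw [← sub_eq_zero, ← map_sub, ← hSapp, hξS]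
  have hξ0 : ∀ x, ξ x = 0 → ∃ y, x = S y := by
    intro x hx
    obtain ⟨c, y, rfl⟩ := hdecomp x
    have : c = 0 := by simpa [hξu, hξS] using hx
    exact ⟨y, by simp [this]⟩
  refine ⟨u, ξ, hξu, hTu, ContinuousLinearMap.ext hξT, fun z hz => ?_⟩
  rw [mem_ball_zero_iff]
  by_contra! hz1
  refine notMem_spectrum_of_bijective (T := T - ξ.smulRight u) (z := z) ?_ hz
  have hform : ∀ x, (T - ξ.smulRight u) x - z • x = T x - z • x - ξ x • u := fun x => by
    simp only [sub_apply, ContinuousLinearMap.smulRight_apply]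
    abel
  simp only [hform]
  have hz0 : z ≠ 0 := fun h => by norm_num [h] at hz1
  -- bijectivity of `T - z` on the kernel of `ξ`
  have hbij : (∀ x, ξ x = 0 → T x - z • x = 0 → x = 0) ∧
      ∀ y, ξ y = 0 → ∃ x, ξ x = 0 ∧ T x - z • x = y := by
    by_cases h1 : z = 1
    · subst h1
      refine ⟨fun x hx h => ?_, fun y hy => ?_⟩
      · obtain ⟨w, rfl⟩ := hξ0 x hx
        exact hker2 w (by rw [hSapp]; simpa using h)
      · obtain ⟨w, rfl⟩ := hξ0 y hy
        obtain ⟨⟨_, x, rfl⟩, hx⟩ := hRsurj ⟨S w, w, rfl⟩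
        exact ⟨S x, hξS x, by rw [one_smul, ← hSapp]; exact congrArg Subtype.val hx⟩
    · have hb := bijective_sub_smul_of_notMem_spectrum (T := T) (z := z)
        fun h => absurd (hspec z h h1) (not_lt.2 hz1)
      refine ⟨fun x _ h => hb.1 (by simpa using h), fun y hy => ?_⟩
      obtain ⟨x, hx⟩ := hb.2 y
      refine ⟨x, ?_, hx⟩
      have hx' : T x - z • x = y := hx
      rw [← hx', map_sub, hξT, map_smul, smul_eq_mul, ← one_sub_mul] at hy
      exact (mul_eq_zero.1 hy).resolve_left (sub_ne_zero.2 (Ne.symm h1))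
  -- Subtracting `ξ.smulRight u` moves the eigenvalue `1` on `u` to `0`, so along `u` the operator
  -- minus `z` is multiplication by `-z`, which is invertible.
  have hξf : ∀ x, ξ (T x - z • x - ξ x • u) = -z * ξ x := fun x => by
    simp [hξT, hξu]
  constructor
  · intro x y hxy
    have hxy' : T (x - y) - z • (x - y) - ξ (x - y) • u = 0 := by
      have h : T x - z • x - ξ x • u = T y - z • y - ξ y • u := hxy
      rw [map_sub, map_sub, smul_sub, sub_smul, ← sub_eq_zero.2 h]
      abel
    have h0 : ξ (x - y) = 0 := by
      have := hξf (x - y)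
      rw [hxy', map_zero] at this
      exact (mul_eq_zero.1 this.symm).resolve_left (neg_ne_zero.2 hz0)
    rw [h0, zero_smul, sub_zero] at hxy'
    exact sub_eq_zero.1 (hbij.1 _ h0 hxy')
  · intro y
    obtain ⟨x, hx, hxy⟩ := hbij.2 (y - ξ y • u) (by simp [hξu])
    refine ⟨x + (-z⁻¹ * ξ y) • u, ?_⟩
    have hc : ξ (x + (-z⁻¹ * ξ y) • u) = -z⁻¹ * ξ y := by simp [hx, hξu]
    simp only [hc]
    rw [map_add, map_smul, hTu, smul_add, smul_smul]
    have h2 : z * (-z⁻¹ * ξ y) = - ξ y := by field_simp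
    rw [h2, neg_smul]
    have : T x = y - ξ y • u + z • x := by rw [← hxy]; abel
    rw [this]
    abel

end SpectralGap

/-! ### Geometric decay of operator powers. -/

section PowerBounds

variable {B : Type*} [NormedAddCommGroup B] [NormedSpace ℂ B] [CompleteSpace B]

/-- By compactness of the spectrum the spectral radius is less than one, and Gelfand's formula
transfers this to a power. -/
theorem exists_norm_pow_lt_one {T : B →L[ℂ] B} (hT : spectrum ℂ T ⊆ Metric.ball 0 1) :
    ∃ n : ℕ, 0 < n ∧ ‖T ^ n‖ < 1 := by
  rcases subsingleton_or_nontrivial B with h | h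
  · exact ⟨1, one_pos, by rw [Subsingleton.elim (T ^ 1) 0, norm_zero]; exact one_pos⟩
  have hr : spectralRadius ℂ T < 1 := by
    have := spectrum.spectralRadius_lt_of_forall_lt T (r := 1) fun z hz => by
      have := hT hz
      rw [mem_ball_zero_iff] at this
      exact_mod_cast this
    simpa using this
  have hg := (spectrum.pow_nnnorm_pow_one_div_tendsto_nhds_spectralRadius T).eventually
    (gt_mem_nhds hr)
  obtain ⟨n, hn, hn0⟩ := (hg.and (eventually_gt_atTop 0)).exists
  refine ⟨n, hn0, ?_⟩
  by_contra! h1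
  refine absurd hn (not_lt.2 ?_)
  exact ENNReal.one_le_rpow (by exact_mod_cast h1) (by positivity)

/-- Geometric decay of the powers, locally uniform in a parameter. -/
theorem exists_pow_bound {X : Type*} [TopologicalSpace X] {A : X → B →L[ℂ] B} {x₀ : X}
    (hA : ContinuousAt A x₀) (hT : spectrum ℂ (A x₀) ⊆ Metric.ball 0 1) :
    ∃ C κ : ℝ, 0 < κ ∧ κ < 1 ∧ ∀ᶠ x in 𝓝 x₀, ∀ N : ℕ, ‖A x ^ N‖ ≤ C * κ ^ N := by
  rcases subsingleton_or_nontrivial B with h | h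
  · refine ⟨0, 1 / 2, by norm_num, by norm_num, Eventually.of_forall fun x N => ?_⟩
    rw [Subsingleton.elim (A x ^ N) 0, norm_zero]; simp
  obtain ⟨n, hn, hlt⟩ := exists_norm_pow_lt_one hT
  obtain ⟨θ, hθ, hθ1⟩ := exists_between hlt
  have hθ0 : 0 < θ := (norm_nonneg _).trans_lt hθ
  set D := ‖A x₀‖ + 1 with hD
  have hD1 : 1 ≤ D := by simp [hD]
  set κ := θ ^ (1 / (n : ℝ)) with hκ
  have hκ0 : 0 < κ := Real.rpow_pos_of_pos hθ0 _
  have hκ1 : κ < 1 := Real.rpow_lt_one hθ0.le hθ1 (by positivity)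
  have hκn : κ ^ n = θ := by
    rw [hκ, ← Real.rpow_natCast, ← Real.rpow_mul hθ0.le, one_div,
      inv_mul_cancel₀ (by positivity), Real.rpow_one]
  -- The condition `‖A x ^ n‖ < θ` on one fixed power is open in `x`. Writing `N = n (N / n) + N %
  -- n`, the factor `D ^ n` bounds the leftover power and `(κ ^ n)⁻¹` pays for replacing `n (N / n)`
  -- by `N`.
  refine ⟨D ^ n * (κ ^ n)⁻¹, κ, hκ0, hκ1, ?_⟩
  have h1 : ∀ᶠ x in 𝓝 x₀, ‖A x ^ n‖ < θ :=
    (hA.pow n).norm.eventually (gt_mem_nhds hθ)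
  have h2 : ∀ᶠ x in 𝓝 x₀, ‖A x‖ < D :=
    hA.norm.eventually (gt_mem_nhds (by simp [hD]))
  filter_upwards [h1, h2] with x hx1 hx2 N
  have hs : N % n < n := Nat.mod_lt _ hn
  calc ‖A x ^ N‖ = ‖(A x ^ n) ^ (N / n) * A x ^ (N % n)‖ := by
        rw [← pow_mul, ← pow_add, Nat.div_add_mod]
    _ ≤ ‖A x ^ n‖ ^ (N / n) * ‖A x‖ ^ (N % n) :=
        (norm_mul_le _ _).trans (mul_le_mul (norm_pow_le _ _) (norm_pow_le _ _)
          (norm_nonneg _) (by positivity))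
    _ ≤ θ ^ (N / n) * D ^ n := by
        gcongr
        exact (pow_le_pow_left₀ (norm_nonneg _) hx2.le _).trans (pow_le_pow_right₀ hD1 hs.le)
    _ = D ^ n * κ ^ (n * (N / n)) := by rw [pow_mul, hκn, mul_comm]
    _ ≤ D ^ n * ((κ ^ n)⁻¹ * κ ^ N) := by
        gcongr
        rw [inv_mul_eq_div, le_div_iff₀ (by positivity), ← pow_add]
        refine pow_le_pow_of_le_one hκ0.le hκ1.le ?_
        have := Nat.div_add_mod N n
        omega
    _ = _ := by ring

/-- Geometric decay of the powers, uniform over a compact set of parameters. -/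
theorem exists_pow_bound_of_isCompact {X : Type*} [TopologicalSpace X] {A : X → B →L[ℂ] B}
    {K : Set X} (hK : IsCompact K) (hA : Continuous A)
    (hT : ∀ x ∈ K, spectrum ℂ (A x) ⊆ Metric.ball 0 1) :
    ∃ C κ : ℝ, 0 < κ ∧ κ < 1 ∧ ∀ x ∈ K, ∀ N : ℕ, ‖A x ^ N‖ ≤ C * κ ^ N := by
  refine hK.induction_on (p := fun K => ∃ C κ : ℝ, 0 < κ ∧ κ < 1 ∧
    ∀ x ∈ K, ∀ N : ℕ, ‖A x ^ N‖ ≤ C * κ ^ N) ?_ ?_ ?_ ?_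
  · exact ⟨0, 1 / 2, by norm_num, by norm_num, by simp⟩
  · rintro s t hst ⟨C, κ, h0, h1, h⟩
    exact ⟨C, κ, h0, h1, fun x hx => h x (hst hx)⟩
  · rintro s t ⟨C, κ, h0, h1, h⟩ ⟨C', κ', h0', h1', h'⟩
    refine ⟨max |C| |C'|, max κ κ', lt_max_of_lt_left h0, max_lt h1 h1', ?_⟩
    rintro x (hx | hx) N
    · refine (h x hx N).trans (mul_le_mul ((le_abs_self C).trans (le_max_left _ _))
        (pow_le_pow_left₀ h0.le (le_max_left _ _) _) (by positivity) (by positivity))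
    · refine (h' x hx N).trans (mul_le_mul ((le_abs_self C').trans (le_max_right _ _))
        (pow_le_pow_left₀ h0'.le (le_max_right _ _) _) (by positivity) (by positivity))
  · intro x hx
    obtain ⟨C, κ, h0, h1, h⟩ := exists_pow_bound hA.continuousAt (hT x hx)
    exact ⟨_, mem_nhdsWithin_of_mem_nhds h, C, κ, h0, h1, fun y hy => hy⟩

end PowerBounds

/-! ### Perturbation of the leading eigenvalue. -/

section Perturbation

variable {B : Type*} [NormedAddCommGroup B] [NormedSpace ℂ B]

/-- The complementary operator maps into the kernel of `η`, where it agrees with `M`. Its zeroth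
power is the identity rather than the complementary projection, hence `N ≥ 1`. -/
theorem pow_apply_of_eigenpair {M : B →L[ℂ] B} {e : B} {η : B →L[ℂ] ℂ} {z : ℂ}
    (he : M e = z • e) (hη : ∀ x, η (M x) = z * η x) (h1 : η e = 1) (v : B) {N : ℕ} (hN : 1 ≤ N) :
    (M ^ N) v = (z ^ N * η v) • e + ((M - z • η.smulRight e) ^ N) v := by
  have hηΛ : ∀ x, η ((M - z • η.smulRight e) x) = 0 := fun x => by simp [hη, h1]
  induction N, hN using Nat.le_induction with
  | base => simp [smul_smul]
  | succ N hN ih =>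
    have h0 : η (((M - z • η.smulRight e) ^ N) v) = 0 := by
      obtain ⟨k, rfl⟩ := Nat.exists_eq_succ_of_ne_zero (by omega : N ≠ 0)
      rw [pow_succ']
      exact hηΛ _
    have h2 : ∀ x, η x = 0 → (M - z • η.smulRight e) x = M x := fun x hx => by simp [hx]
    rw [pow_succ', pow_succ' (M - z • η.smulRight e), mul_apply_eq_comp,
      mul_apply_eq_comp, ih, map_add, map_smul, he, h2 _ h0, smul_smul]
    congr 2
    ring

variable [CompleteSpace B]

/-- Perturbation of a simple leading eigenvalue. -/
theorem exists_leading_eigenvalue {L : ℝ → B →L[ℂ] B} {s : ℕ} (hs : 1 ≤ s)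
    (hL : ContDiffAt ℝ s L 0) (hA2 : AssumptionA2 (L 0)) (v : B) (l : B →L[ℂ] ℂ) :
    ∃ (lam Z : ℝ → ℂ) (C κ : ℝ), ContDiffAt ℝ s lam 0 ∧ ContDiffAt ℝ s Z 0 ∧ lam 0 = 1 ∧
      0 < κ ∧ κ < 1 ∧ ∀ᶠ t in 𝓝 (0 : ℝ), ∀ N : ℕ, 1 ≤ N →
        ‖l ((L t ^ N) v) - lam t ^ N * Z t‖ ≤ C * κ ^ N := by
  obtain ⟨e, ξ, hξe, hTe, hξT, hspec⟩ := exists_leading_eigenpair hA2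
  -- An algebraic substitute for Riesz projections. Subtracting a rank-one operator removes the
  -- leading eigenvalue, so `U (t, z) = z - A t` is invertible near `(0, 1)`. For `x` with `ξ x =
  -- 1`, the equation `L t x = z x` is equivalent to `U (t, z) x = a t`. Thus `z` is an eigenvalue
  -- with eigenvector `R a` as soon as `F = ξ (R a) = 1`.
  set a : ℝ → B := fun t => L t e with ha
  set A : ℝ → B →L[ℂ] B := fun t => L t - ξ.smulRight (a t) with hA
  have ha0 : a 0 = e := hTe
  have hA0 : A 0 = L 0 - ξ.smulRight e := by simp only [hA, ha0]
  have happ : ContDiff ℝ s fun p : (B →L[ℂ] B) × B => p.1 p.2 :=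
    (isBoundedBilinearMap_apply (𝕜 := ℂ) (E := B) (F := B)).contDiff.restrict_scalars ℝ
  have hac : ContDiffAt ℝ s a 0 := happ.contDiffAt.comp 0 (hL.prodMk contDiffAt_const)
  have hAc : ContDiffAt ℝ s A 0 := by
    have h : ContDiff ℝ s fun x : B => ξ.smulRight x :=
      (ContinuousLinearMap.smulRightL ℂ B B ξ).contDiff.restrict_scalars ℝ
    exact hL.sub (h.contDiffAt.comp 0 hac)
  set U : ℝ × ℂ → B →L[ℂ] B := fun p => p.2 • (1 : B →L[ℂ] B) - A p.1 with hU
  set R : ℝ × ℂ → B →L[ℂ] B := fun p => Ring.inverse (U p) with hR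
  have hu1 : IsUnit (U (0, 1)) := by
    have : (1 : ℂ) ∉ spectrum ℂ (A 0) := fun h => by
      have := hspec (hA0 ▸ h)
      rw [mem_ball_zero_iff] at this
      norm_num at this
    rw [spectrum.notMem_iff] at this
    simpa [hU, Algebra.algebraMap_eq_smul_one] using this
  have hA1 : ContDiffAt ℝ s (fun p : ℝ × ℂ => A p.1) (0, 1) :=
    ContDiffAt.comp (0, 1) (g := A) hAc contDiffAt_fst
  have hUc : ContDiffAt ℝ s U (0, 1) := by
    refine ContDiffAt.sub ?_ hA1
    have h : ContDiff ℝ s fun z : ℂ => z • (1 : B →L[ℂ] B) :=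
      (contDiff_id.smul contDiff_const).restrict_scalars ℝ (𝕜' := ℂ)
    exact h.contDiffAt.comp (0, 1) contDiffAt_snd
  have hRc : ContDiffAt ℝ s R (0, 1) := by
    obtain ⟨u, hu⟩ := hu1
    have h1 : ContDiffAt ℝ s Ring.inverse (u : B →L[ℂ] B) := contDiffAt_ringInverse ℝ u
    rw [hu] at h1
    exact ContDiffAt.comp (0, 1) h1 hUc
  have ha1 : ContDiffAt ℝ s (fun p : ℝ × ℂ => a p.1) (0, 1) :=
    ContDiffAt.comp (0, 1) (g := a) hac contDiffAt_fst
  set E : ℝ × ℂ → B := fun p => R p (a p.1) with hE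
  have hEc : ContDiffAt ℝ s E (0, 1) := happ.contDiffAt.comp (0, 1) (hRc.prodMk ha1)
  have hξc : ∀ f : B →L[ℂ] ℂ, ContDiff ℝ s f := fun f => f.contDiff.restrict_scalars ℝ
  set F : ℝ × ℂ → ℂ := fun p => ξ (E p) with hF
  have hFc : ContDiffAt ℝ s F (0, 1) := (hξc ξ).contDiffAt.comp (0, 1) hEc
  have hE0 : ∀ z : ℂ, IsUnit (U (0, z)) → z ≠ 0 → E (0, z) = z⁻¹ • e := by
    intro z hz hz0
    have h1 : U (0, z) (z⁻¹ • e) = e := by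
      simp [hU, hA0, hTe, hξe, smul_smul, hz0]
    have h2 : R (0, z) (U (0, z) (z⁻¹ • e)) = z⁻¹ • e := by
      rw [← mul_apply_eq_comp, hR]
      simp only
      rw [Ring.inverse_mul_cancel _ hz]
      rfl
    rw [h1] at h2
    rw [hE]
    simp only [ha0]
    exact h2
  have hUev : ∀ᶠ p in 𝓝 ((0 : ℝ), (1 : ℂ)), IsUnit (U p) :=
    hUc.continuousAt.eventually (Units.isOpen.mem_nhds hu1)
  have hF0 : (fun z : ℂ => F (0, z)) =ᶠ[𝓝 1] fun z => z⁻¹ := by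
    have hc : Tendsto (fun z : ℂ => ((0 : ℝ), z)) (𝓝 1) (𝓝 (0, 1)) :=
      (Continuous.prodMk_right (0 : ℝ)).tendsto 1
    filter_upwards [hc.eventually hUev, eventually_ne_nhds one_ne_zero] with z h1 h2
    simp only [hF]
    rw [hE0 z h1 h2, map_smul, hξe, smul_eq_mul, mul_one]
  have hs0 : (s : WithTop ℕ∞) ≠ 0 := by
    have : s ≠ 0 := by omega
    exact_mod_cast this
  -- At `t = 0` the function is `z ↦ z⁻¹`, whose derivative at `1` is `-1`, so the implicit function
  -- theorem applies.
  have hinv : (fderiv ℝ F (0, 1) ∘L .inr ℝ ℝ ℂ).IsInvertible := by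
    have h1 : HasFDerivAt (fun z : ℂ => F (0, z)) (fderiv ℝ F (0, 1) ∘L .inr ℝ ℝ ℂ) 1 :=
      (hFc.differentiableAt hs0).hasFDerivAt.comp (1 : ℂ) (hasFDerivAt_prodMk_right (0 : ℝ) 1)
    have h2 := ((hasDerivAt_inv (one_ne_zero (α := ℂ))).hasFDerivAt.restrictScalars ℝ).congr_of_eventuallyEq hF0
    rw [h1.unique h2]
    refine ⟨ContinuousLinearEquiv.neg ℝ, ?_⟩
    ext z; simp
  set lam := hFc.implicitFunction hs0 hinv with hlam
  have hlamc : ContDiffAt ℝ s lam 0 := hFc.contDiffAt_implicitFunction hs0 hinv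
  have hlam0 : lam 0 = 1 := hFc.implicitFunction_apply_self hs0 hinv
  have hFlam : ∀ᶠ t in 𝓝 (0 : ℝ), F (t, lam t) = 1 := by
    have h := hFc.eventually_apply_implicitFunction hs0 hinv
    have h1 : F (0, 1) = 1 := by simpa using hF0.self_of_nhds
    filter_upwards [h] with t ht
    rw [ht, h1]
  have hpair : ContDiffAt ℝ s (fun t : ℝ => (t, lam t)) 0 := contDiffAt_id.prodMk hlamc
  have hcomp : ∀ {Y : Type _} [NormedAddCommGroup Y] [NormedSpace ℝ Y] {g : ℝ × ℂ → Y},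
      ContDiffAt ℝ s g (0, 1) → ContDiffAt ℝ s (fun t => g (t, lam t)) 0 := by
    intro Y _ _ g hg
    exact ContDiffAt.comp (0 : ℝ) (f := fun t : ℝ => (t, lam t)) (by rw [hlam0]; exact hg) hpair
  set ε : ℝ → B := fun t => E (t, lam t) with hε
  have hεc : ContDiffAt ℝ s ε 0 := hcomp hEc
  -- The left eigenvector, dual to the right eigenvector `ε t`; dividing by `n t` below normalises
  -- the pairing to one.
  set ζ : ℝ → B →L[ℂ] ℂ := fun t => ξ ∘L R (t, lam t) with hζ
  have hζc : ContDiffAt ℝ s ζ 0 := by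
    have h : ContDiff ℝ s fun M : B →L[ℂ] B => ξ ∘L M :=
      (ContinuousLinearMap.compL ℂ B B ℂ ξ).contDiff.restrict_scalars ℝ
    exact h.contDiffAt.comp 0 (hcomp hRc)
  have hε0 : ε 0 = e := by
    simp only [hε, hlam0]
    rw [hE0 1 hu1 one_ne_zero, inv_one, one_smul]
  have hζ0 : ζ 0 = ξ := by
    ext x
    have h1 : ∀ y, ξ (U (0, 1) y) = ξ y := fun y => by
      have : ξ (L 0 y) = ξ y := congrArg (fun f : B →L[ℂ] ℂ => f y) hξT
      simp [hU, hA0, hξe, this]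
    have h2 : U (0, 1) (R (0, 1) x) = x := by
      rw [← mul_apply_eq_comp, hR]
      simp only
      rw [Ring.mul_inverse_cancel _ hu1]
      rfl
    simp only [hζ, hlam0, ContinuousLinearMap.comp_apply]
    rw [← h1, h2]
  set n : ℝ → ℂ := fun t => ζ t (ε t) with hn
  have hnc : ContDiffAt ℝ s n 0 := by
    have happ' : ContDiff ℝ s fun p : (B →L[ℂ] ℂ) × B => p.1 p.2 :=
      (isBoundedBilinearMap_apply (𝕜 := ℂ) (E := B) (F := ℂ)).contDiff.restrict_scalars ℝ
    exact happ'.contDiffAt.comp 0 (hζc.prodMk hεc)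
  have hn0 : n 0 = 1 := by simp only [hn, hζ0, hε0, hξe]
  have hnev : ∀ᶠ t in 𝓝 (0 : ℝ), n t ≠ 0 :=
    hnc.continuousAt.eventually_ne (by rw [hn0]; exact one_ne_zero)
  set η : ℝ → B →L[ℂ] ℂ := fun t => (n t)⁻¹ • ζ t with hη
  have hηc : ContinuousAt η 0 :=
    (hnc.continuousAt.inv₀ (by rw [hn0]; exact one_ne_zero)).smul hζc.continuousAt
  set Λ : ℝ → B →L[ℂ] B := fun t => L t - lam t • (η t).smulRight (ε t) with hΛ
  have hΛc : ContinuousAt Λ 0 := by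
    refine hL.continuousAt.sub (hlamc.continuousAt.smul ?_)
    have : Continuous fun p : (B →L[ℂ] ℂ) × B => p.1.smulRight p.2 :=
      (ContinuousLinearMap.smulRightL ℂ B B).continuous₂
    exact this.continuousAt.comp (hηc.prodMk hεc.continuousAt)
  have hΛ0 : Λ 0 = L 0 - ξ.smulRight e := by
    simp only [hΛ, hη, hlam0, hn0, hζ0, hε0, inv_one, one_smul]
  -- Only continuity of the complementary part is needed, since it contributes only an exponentially
  -- small error.
  obtain ⟨C, κ, hκ0, hκ1, hb⟩ := exists_pow_bound hΛc (by rw [hΛ0]; exact hspec)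
  refine ⟨lam, fun t => (n t)⁻¹ * ζ t v * l (ε t), ‖l‖ * C * ‖v‖, κ, hlamc, ?_, hlam0, hκ0, hκ1, ?_⟩
  · refine ((hnc.inv (by rw [hn0]; exact one_ne_zero)).mul ?_).mul ((hξc l).contDiffAt.comp 0 hεc)
    have h : ContDiff ℝ s fun f : B →L[ℂ] ℂ => f v :=
      (ContinuousLinearMap.apply ℂ ℂ v).contDiff.restrict_scalars ℝ
    exact h.contDiffAt.comp 0 hζc
  have hUlam : ∀ᶠ t in 𝓝 (0 : ℝ), IsUnit (U (t, lam t)) := by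
    have := hpair.continuousAt.tendsto
    simp only [hlam0] at this
    exact this.eventually hUev
  filter_upwards [hb, hnev, hUlam, hFlam] with t hbt hnt hut hFt N hN
  have hUR : ∀ x, U (t, lam t) (R (t, lam t) x) = x := fun x => by
    rw [← mul_apply_eq_comp, hR]
    simp only
    rw [Ring.mul_inverse_cancel _ hut]
    rfl
  have hRU : ∀ x, R (t, lam t) (U (t, lam t) x) = x := fun x => by
    rw [← mul_apply_eq_comp, hR]
    simp only
    rw [Ring.inverse_mul_cancel _ hut]
    rfl
  have hUx : ∀ x, U (t, lam t) x = lam t • x - L t x + ξ x • a t := fun x => by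
    simp only [hU, hA, sub_apply, smul_apply, ContinuousLinearMap.smulRight_apply,
      one_apply_eq_self]
    abel
  have hLε : L t (ε t) = lam t • ε t := by
    have h1 := hUR (a t)
    have h2 : ξ (ε t) = 1 := hFt
    change U (t, lam t) (ε t) = a t at h1
    rw [hUx, h2, one_smul, add_eq_right, sub_eq_zero] at h1
    exact h1.symm
  have hζL : ∀ x, ζ t (L t x) = lam t * ζ t x := by
    intro x
    have h1 : L t x = lam t • x - U (t, lam t) x + ξ x • a t := by rw [hUx]; abel
    have h2 : ζ t (U (t, lam t) x) = ξ x := congrArg ξ (hRU x)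
    have h3 : ζ t (a t) = 1 := hFt
    rw [h1, map_add, map_sub, map_smul, map_smul, h2, h3]
    simp
  have hηL : ∀ x, η t (L t x) = lam t * η t x := fun x => by
    simp only [hη, smul_apply, smul_eq_mul, hζL]
    ring
  have hηε : η t (ε t) = 1 := by
    simp only [hη, smul_apply, smul_eq_mul]
    exact inv_mul_cancel₀ hnt
  rw [pow_apply_of_eigenpair hLε hηL hηε v hN, map_add, map_smul]
  have : (lam t ^ N * (η t) v) • l (ε t) + l (((L t - lam t • (η t).smulRight (ε t)) ^ N) v) -
      lam t ^ N * ((n t)⁻¹ * ζ t v * l (ε t)) = l ((Λ t ^ N) v) := by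
    simp only [hη, hΛ, smul_apply, smul_eq_mul]
    ring
  rw [this]
  calc ‖l ((Λ t ^ N) v)‖ ≤ ‖l‖ * (‖Λ t ^ N‖ * ‖v‖) :=
        (l.le_opNorm _).trans (by gcongr; exact ContinuousLinearMap.le_opNorm _ _)
    _ ≤ ‖l‖ * (C * κ ^ N * ‖v‖) := by gcongr; exact hbt N
    _ = _ := by ring

end Perturbation

/-! ### Fast decay at intermediate frequencies. -/

section HighFrequencies

variable {B : Type*} [NormedAddCommGroup B] [NormedSpace ℂ B]

/-- The exponent is at least `N ^ (1 - θ) / 2 - 1`, so the factor is a stretched exponential and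
beats every power of `N`. -/
theorem tendsto_natCast_pow_mul_pow_div_ceil {x θ : ℝ} (hx0 : 0 < x) (hx1 : x < 1)
    (hθ0 : 0 < θ) (hθ1 : θ < 1) (j : ℕ) :
    Tendsto (fun N : ℕ => (N : ℝ) ^ j * x ^ (N / ⌈(N : ℝ) ^ θ⌉₊)) atTop (𝓝 0) := by
  set c := -Real.log x with hc
  have hc0 : 0 < c := neg_pos.2 (Real.log_neg hx0 hx1)
  have h1θ : 0 < 1 - θ := by linarith
  have hy : Tendsto (fun N : ℕ => (N : ℝ) ^ (1 - θ)) atTop atTop :=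
    (tendsto_rpow_atTop h1θ).comp tendsto_natCast_atTop_atTop
  have hlim := ((tendsto_rpow_mul_exp_neg_mul_atTop_nhds_zero (j / (1 - θ)) (c / 2)
    (by positivity)).comp hy).const_mul (Real.exp c)
  rw [mul_zero] at hlim
  refine squeeze_zero' (Eventually.of_forall fun N => by positivity) ?_ hlim
  filter_upwards [eventually_ge_atTop 1] with N hN
  have hN0 : (0 : ℝ) < N := by exact_mod_cast hN
  have hNθ : (1 : ℝ) ≤ (N : ℝ) ^ θ := Real.one_le_rpow (by exact_mod_cast hN) hθ0.le
  set M := ⌈(N : ℝ) ^ θ⌉₊ with hM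
  have hM2 : (M : ℝ) ≤ 2 * (N : ℝ) ^ θ := by
    have := Nat.ceil_lt_add_one (zero_le_one.trans hNθ)
    linarith
  have hM0 : (0 : ℝ) < M := lt_of_lt_of_le (by linarith) (Nat.le_ceil _)
  have hm : (N : ℝ) ^ (1 - θ) / 2 - 1 ≤ ((N / M : ℕ) : ℝ) := by
    have h1 : (N : ℝ) / M < ((N / M : ℕ) : ℝ) + 1 := by
      rw [div_lt_iff₀ hM0]
      have := Nat.lt_div_mul_add (a := N) (by exact_mod_cast hM0 : 0 < M)
      have h3 : N < (N / M + 1) * M := by linarith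
      exact_mod_cast h3
    have h2 : (N : ℝ) ^ (1 - θ) / 2 ≤ N / M := by
      rw [Real.rpow_sub hN0, Real.rpow_one, div_div, mul_comm]
      gcongr
    linarith
  have hpow : x ^ (N / M) = Real.exp (-c * ((N / M : ℕ) : ℝ)) := by
    rw [hc, neg_neg, mul_comm, Real.exp_nat_mul, Real.exp_log hx0]
  have hNj : (N : ℝ) ^ j = ((N : ℝ) ^ (1 - θ)) ^ ((j : ℝ) / (1 - θ)) := by
    rw [← Real.rpow_mul hN0.le, mul_div_cancel₀ _ h1θ.ne', Real.rpow_natCast]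
  simp only [Function.comp_apply]
  rw [hpow, ← hNj, mul_left_comm, ← Real.exp_add]
  gcongr
  nlinarith

/-- For frequencies up to a smaller power of `N`, (A4) gives decay faster than any power. -/
theorem AssumptionA4.exists_fast_decay {L : ℝ → B →L[ℂ] B} {r₁ θ : ℝ} (h : AssumptionA4 L r₁)
    (hθ0 : 0 < θ) (hθ1 : θ < 1) :
    ∃ (K : ℝ) (b : ℕ → ℝ), (∀ j : ℕ, Tendsto (fun N : ℕ => (N : ℝ) ^ j * b N) atTop (𝓝 0)) ∧
      (∀ N, 0 ≤ b N) ∧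
      ∀ᶠ N : ℕ in atTop, ∀ t : ℝ, K ≤ |t| → |t| ≤ (N : ℝ) ^ (θ * r₁) → ‖L t ^ N‖ ≤ b N := by
  obtain ⟨hr₁, K, r₂, N₀, -, hr₂, -, hb⟩ := h
  set x : ℝ := 1 / 2 ^ r₂ with hx
  have hx0 : 0 < x := by positivity
  have hx1 : x < 1 := by
    rw [hx, div_lt_one (by positivity)]
    exact Real.one_lt_rpow (by norm_num) hr₂
  refine ⟨K, fun N => x ^ (N / ⌈(N : ℝ) ^ θ⌉₊),
    tendsto_natCast_pow_mul_pow_div_ceil hx0 hx1 hθ0 hθ1, fun N => by positivity, ?_⟩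
  have hm0 : ∀ᶠ N : ℕ in atTop, x ^ (N / ⌈(N : ℝ) ^ θ⌉₊) < 1 := by
    have := tendsto_natCast_pow_mul_pow_div_ceil hx0 hx1 hθ0 hθ1 0
    simp only [pow_zero, one_mul] at this
    exact this.eventually (gt_mem_nhds one_pos)
  have hNθ : ∀ᶠ N : ℕ in atTop, max N₀ 1 < (N : ℝ) ^ θ :=
    ((tendsto_rpow_atTop hθ0).comp tendsto_natCast_atTop_atTop).eventually_gt_atTop _
  filter_upwards [hm0, hNθ] with N hm hN t ht1 ht2
  set M := ⌈(N : ℝ) ^ θ⌉₊ with hM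
  have hMle : (N : ℝ) ^ θ ≤ M := Nat.le_ceil _
  have hMgt : max N₀ 1 < (M : ℝ) := hN.trans_le hMle
  have hM2 : 2 ≤ M := by
    have : (1 : ℝ) < M := (le_max_right _ _).trans_lt hMgt
    exact_mod_cast this
  -- For `n ≥ M ≥ N ^ θ` the frequency satisfies `|t| ≤ n ^ r₁`, so (A4) holds already for the block
  -- length `n`, and `n ≥ 2` bounds the norm by `x = 2 ^ (-r₂)`.
  have key : ∀ n : ℕ, M ≤ n → ‖L t ^ n‖ ≤ x := by
    intro n hn
    have hnR : (M : ℝ) ≤ n := by exact_mod_cast hn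
    refine (hb n t ((le_max_left _ _).trans_lt (hMgt.trans_le hnR)) ht1 (ht2.trans ?_)).trans ?_
    · rw [Real.rpow_mul (Nat.cast_nonneg N)]
      exact Real.rpow_le_rpow (by positivity) (hMle.trans hnR) hr₁.le
    · have : (2 : ℝ) ≤ n := by exact_mod_cast hM2.trans hn
      rw [hx]
      gcongr
  obtain ⟨m, hm'⟩ : ∃ m, N / M = m + 1 := by
    refine Nat.exists_eq_succ_of_ne_zero fun h0 => ?_
    rw [h0, pow_zero] at hm
    exact lt_irrefl _ hm
  -- The last block absorbs the remainder, so it too has length at least `M`, and all `N / M` blocks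
  -- contribute a factor `x`.
  have hdecomp : N = M * m + (M + N % M) := by
    have := Nat.div_add_mod N M
    rw [hm'] at this
    linarith
  rw [hm', pow_succ]
  calc ‖L t ^ N‖ = ‖L t ^ (M * m) * L t ^ (M + N % M)‖ := by rw [← pow_add, ← hdecomp]
    _ ≤ ‖L t ^ (M * m)‖ * ‖L t ^ (M + N % M)‖ := norm_mul_le _ _
    _ ≤ x ^ m * x := by
      refine mul_le_mul ?_ (key _ (Nat.le_add_right _ _)) (norm_nonneg _) (by positivity)
      rcases m.eq_zero_or_pos with rfl | hm0
      · rw [mul_zero, pow_zero, pow_zero]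
        exact ContinuousLinearMap.norm_id_le
      · rw [pow_mul]
        exact (norm_pow_le' _ hm0).trans (pow_le_pow_left₀ (norm_nonneg _) (key M le_rfl) _)

end HighFrequencies

/-! ### Asymptotic expansions and Gaussian integrals. -/

section Laplace

open Polynomial in
theorem isBigO_pow_mul_eval (n : ℕ) (p : ℂ[X]) :
    (fun t : ℝ => (t : ℂ) ^ n * p.eval (t : ℂ)) =O[𝓝 0] fun t => t ^ n := by
  have h1 : (fun t : ℝ => (t : ℂ) ^ n) =O[𝓝 0] fun t => t ^ n :=
    IsBigO.of_norm_right (isBigO_of_le _ fun t => by simp)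
  have h2 : (fun t : ℝ => p.eval (t : ℂ)) =O[𝓝 0] fun _ => (1 : ℝ) := by
    have : Continuous fun t : ℝ => p.eval (t : ℂ) := by fun_prop
    exact (this.tendsto 0).isBigO_one ℝ
  simpa using h1.mul h2

theorem isBigO_pow_of_le {m n : ℕ} (h : m ≤ n) :
    (fun t : ℝ => t ^ n) =O[𝓝 0] fun t => t ^ m := by
  rw [← Nat.sub_add_cancel h]
  have h2 : (fun t : ℝ => t ^ (n - m)) =O[𝓝 0] fun _ => (1 : ℝ) :=
    ((continuous_pow (n - m)).tendsto (0 : ℝ)).isBigO_one ℝ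
  simpa [pow_add] using h2.mul (isBigO_refl (fun t : ℝ => t ^ m) _)

theorem isLittleO_pow_of_lt {m n : ℕ} (h : m < n) :
    (fun t : ℝ => t ^ n) =o[𝓝 0] fun t => t ^ m :=
  isLittleO_pow_pow h

open Polynomial in
/-- Little-`o` expansions of the coefficients in the exponential series. -/
theorem isLittleO_pow_mul_sub {r : ℕ} {ψ G : ℝ → ℂ} {p g : ℂ[X]}
    (hψ : (fun t => ψ t - (t : ℂ) ^ 3 * p.eval (t : ℂ)) =o[𝓝 0] fun t => t ^ (r + 2))
    (hG : (fun t => G t - g.eval (t : ℂ)) =o[𝓝 0] fun t => t ^ r) (j : ℕ) :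
    ((fun t => ψ t ^ j * G t - ((t : ℂ) ^ 3 * p.eval (t : ℂ)) ^ j * g.eval (t : ℂ)) =o[𝓝 0]
      fun t => t ^ (r + 2 * j)) ∧
    ((fun t => ψ t ^ j - ((t : ℂ) ^ 3 * p.eval (t : ℂ)) ^ j) =o[𝓝 0]
      fun t => t ^ (r + 2 * j)) ∧
    (G =O[𝓝 0] fun _ => (1 : ℝ)) ∧ (ψ =o[𝓝 0] fun t => t ^ 2) := by
  set P : ℝ → ℂ := fun t => (t : ℂ) ^ 3 * p.eval (t : ℂ) with hP
  have hP3 : P =O[𝓝 0] fun t => t ^ 3 := isBigO_pow_mul_eval 3 p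
  have hP2 : P =O[𝓝 0] fun t => t ^ 2 := hP3.trans (isBigO_pow_of_le (by norm_num))
  have hψ2 : ψ =o[𝓝 0] fun t => t ^ 2 := by
    have h1 := hψ.trans_isBigO (isBigO_pow_of_le (Nat.le_add_left 2 r))
    simpa [hP] using h1.add (hP3.trans_isLittleO (isLittleO_pow_of_lt (by norm_num : 2 < 3)))
  have hGO : G =O[𝓝 0] fun _ => (1 : ℝ) := by
    have h1 : (fun t : ℝ => t ^ r) =O[𝓝 0] fun _ => (1 : ℝ) := by
      simpa using isBigO_pow_of_le (Nat.zero_le r)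
    have h2 := isBigO_pow_mul_eval 0 g
    simp only [pow_zero, one_mul] at h2
    simpa using (hG.isBigO.trans h1).add h2
  -- Telescoping: `ψ^(j+1) - P^(j+1) = ψ^j (ψ - P) + (ψ^j - P^j) P`, where each extra factor is
  -- `O(t²)`. The order `r + 2 j` is what balances the factor `N^j √N^r` after rescaling.
  have hpow : ∀ j : ℕ, (fun t => ψ t ^ j - P t ^ j) =o[𝓝 0] fun t => t ^ (r + 2 * j) := by
    intro j
    induction j with
    | zero => simp
    | succ j ih =>
      have h1 := ((hψ2.isBigO.pow j).mul_isLittleO hψ).add (ih.mul_isBigO hP2 |>.congr_right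
        (g₂ := fun t => (t ^ 2) ^ j * t ^ (r + 2)) (fun t => by ring))
      refine h1.congr (fun t => ?_) fun t => ?_
      · simp only [hP]; ring
      · ring
  refine ⟨?_, hpow j, hGO, hψ2⟩
  have h1 := (hpow j).mul_isBigO hGO
  have h2 := (hP2.pow j).mul_isLittleO hG
  refine ((h1.congr_right (g₂ := fun t => t ^ (r + 2 * j)) fun t => by ring).add
    (h2.congr_right fun t => by ring)).congr_left fun t => ?_
  simp only [hP]
  ring

theorem integrable_exp_neg_mul_sq_mul_abs_pow {c : ℝ} (hc : 0 < c) (n : ℕ) :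
    Integrable fun s : ℝ => Real.exp (-c * s ^ 2) * |s| ^ n := by
  have h := (integrable_rpow_mul_exp_neg_mul_sq hc (s := n) (by
    have : (0 : ℝ) ≤ n := Nat.cast_nonneg n
    linarith)).norm
  refine h.congr (Eventually.of_forall fun s => ?_)
  simp [Real.abs_exp, mul_comm]

/-- The sequence `a` has an asymptotic expansion in powers of `1 / N` up to `o(N ^ (-r/2))`. -/
def HasExpansion (r : ℕ) (a : ℕ → ℂ) : Prop :=
  ∃ β : ℕ → ℂ, Tendsto (fun N : ℕ => ((√(N : ℝ) : ℝ) : ℂ) ^ r *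
    (a N - ∑ p ∈ Finset.range (r / 2 + 1), β p / (N : ℂ) ^ p)) atTop (𝓝 0)

theorem HasExpansion.add {r : ℕ} {a b : ℕ → ℂ} (ha : HasExpansion r a) (hb : HasExpansion r b) :
    HasExpansion r fun N => a N + b N := by
  obtain ⟨β, hβ⟩ := ha
  obtain ⟨γ, hγ⟩ := hb
  refine ⟨fun p => β p + γ p, ?_⟩
  have := hβ.add hγ
  rw [add_zero] at this
  refine this.congr fun N => ?_
  simp only [add_div, Finset.sum_add_distrib]
  ring

theorem HasExpansion.const_mul {r : ℕ} {a : ℕ → ℂ} (ha : HasExpansion r a) (z : ℂ) :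
    HasExpansion r fun N => z * a N := by
  obtain ⟨β, hβ⟩ := ha
  refine ⟨fun p => z * β p, ?_⟩
  have := hβ.const_mul z
  rw [mul_zero] at this
  refine this.congr fun N => ?_
  simp only [mul_div_assoc, ← Finset.mul_sum]
  ring

theorem HasExpansion.of_tendsto_zero {r : ℕ} {a : ℕ → ℂ}
    (ha : Tendsto (fun N : ℕ => ((√(N : ℝ) : ℝ) : ℂ) ^ r * a N) atTop (𝓝 0)) :
    HasExpansion r a :=
  ⟨0, by simpa using ha⟩

theorem HasExpansion.congr_of_tendsto {r : ℕ} {a b : ℕ → ℂ} (ha : HasExpansion r a)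
    (h : Tendsto (fun N : ℕ => ((√(N : ℝ) : ℝ) : ℂ) ^ r * (b N - a N)) atTop (𝓝 0)) :
    HasExpansion r b := by
  simpa using ha.add (.of_tendsto_zero h)

theorem HasExpansion.congr {r : ℕ} {a b : ℕ → ℂ} (ha : HasExpansion r a) (h : ∀ N, a N = b N) :
    HasExpansion r b :=
  funext h ▸ ha

theorem HasExpansion.sum {ι : Type*} {r : ℕ} (s : Finset ι) {a : ι → ℕ → ℂ}
    (ha : ∀ i ∈ s, HasExpansion r (a i)) : HasExpansion r fun N => ∑ i ∈ s, a i N := by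
  classical
  induction s using Finset.induction_on with
  | empty => exact .of_tendsto_zero (by simp)
  | insert i s hi ih =>
    simp only [Finset.sum_insert hi]
    exact (ha i (by simp)).add (ih fun j hj => ha j (by simp [hj]))

theorem tendsto_sqrt_natCast : Tendsto (fun N : ℕ => √(N : ℝ)) atTop atTop :=
  Real.tendsto_sqrt_atTop.comp tendsto_natCast_atTop_atTop

theorem ofReal_sqrt_sq (N : ℕ) : ((√(N : ℝ) : ℝ) : ℂ) ^ 2 = N := by
  rw [← Complex.ofReal_pow, Real.sq_sqrt (Nat.cast_nonneg N)]; simp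

/-- Outside the window `√N ≤ |s| / δ`, so the factor `√N ^ r` is absorbed into the integrand as `|s|
^ r`, and dominated convergence applies. -/
theorem tendsto_sqrt_pow_mul_gaussian_tail {c δ : ℝ} (hc : 0 < c) (hδ : 0 < δ) (r n : ℕ) :
    Tendsto (fun N : ℕ => ((√(N : ℝ) : ℝ) : ℂ) ^ r *
      ((∫ s in -(√(N : ℝ) * δ)..√(N : ℝ) * δ, ((Real.exp (-c * s ^ 2) : ℝ) : ℂ) * (s : ℂ) ^ n) -
        ∫ s : ℝ, ((Real.exp (-c * s ^ 2) : ℝ) : ℂ) * (s : ℂ) ^ n)) atTop (𝓝 0) := by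
  set f : ℝ → ℂ := fun s => ((Real.exp (-c * s ^ 2) : ℝ) : ℂ) * (s : ℂ) ^ n with hf
  have hfn : ∀ s, ‖f s‖ = Real.exp (-c * s ^ 2) * |s| ^ n := fun s => by
    simp only [hf, norm_mul, norm_pow, Complex.norm_real, Real.norm_eq_abs, Real.abs_exp]
  have hfc : Continuous f := by fun_prop
  have hfi : Integrable f :=
    (integrable_exp_neg_mul_sq_mul_abs_pow hc n).mono' hfc.aestronglyMeasurable
      (Eventually.of_forall fun s => (hfn s).le)
  set S : ℕ → Set ℝ := fun N => Set.Ioc (-(√(N : ℝ) * δ)) (√(N : ℝ) * δ) with hS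
  have hrw : ∀ N : ℕ, ((√(N : ℝ) : ℝ) : ℂ) ^ r *
      ((∫ s in -(√(N : ℝ) * δ)..√(N : ℝ) * δ, f s) - ∫ s : ℝ, f s) =
      ∫ s, (S N)ᶜ.indicator (fun s => -((√(N : ℝ) : ℝ) : ℂ) ^ r * f s) s := by
    intro N
    have h0 : 0 ≤ √(N : ℝ) * δ := by positivity
    rw [integral_indicator measurableSet_Ioc.compl, integral_const_mul,
      intervalIntegral.integral_of_le (by linarith),
      ← integral_add_compl (measurableSet_Ioc (a := -(√(N : ℝ) * δ)) (b := √(N : ℝ) * δ)) hfi]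
    ring
  simp_rw [hrw]
  rw [← integral_zero ℝ ℂ (μ := volume)]
  refine tendsto_integral_of_dominated_convergence
    (fun s => (δ⁻¹) ^ r * (Real.exp (-c * s ^ 2) * |s| ^ (n + r))) ?_ ?_ ?_ ?_
  · intro N
    exact (Continuous.aestronglyMeasurable (by fun_prop)).indicator measurableSet_Ioc.compl
  · exact (integrable_exp_neg_mul_sq_mul_abs_pow hc _).const_mul _
  · intro N
    refine Eventually.of_forall fun s => ?_
    by_cases hs : s ∈ (S N)ᶜ
    · rw [Set.indicator_of_mem hs, norm_mul, hfn, norm_neg, norm_pow, Complex.norm_real,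
        Real.norm_of_nonneg (Real.sqrt_nonneg _)]
      have h1 : √(N : ℝ) ≤ δ⁻¹ * |s| := by
        have h2 : √(N : ℝ) * δ ≤ |s| := by
          by_contra! hlt
          rw [abs_lt] at hlt
          exact hs ⟨hlt.1, hlt.2.le⟩
        rw [inv_mul_eq_div, le_div_iff₀ hδ]
        exact h2
      calc √(N : ℝ) ^ r * (Real.exp (-c * s ^ 2) * |s| ^ n)
          ≤ (δ⁻¹ * |s|) ^ r * (Real.exp (-c * s ^ 2) * |s| ^ n) := by gcongr
        _ = _ := by ring
    · rw [Set.indicator_of_notMem hs, norm_zero]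
      positivity
  · refine Eventually.of_forall fun s => ?_
    refine tendsto_const_nhds.congr' ?_
    have := (tendsto_sqrt_natCast.atTop_mul_const hδ).eventually_gt_atTop |s|
    filter_upwards [this] with N hN
    rw [abs_lt] at hN
    rw [Set.indicator_of_notMem (not_not.2 ⟨hN.1, hN.2.le⟩)]

theorem tendsto_sqrt_pow_div_natCast_pow {r p : ℕ} (h : r / 2 < p) :
    Tendsto (fun N : ℕ => ((√(N : ℝ) : ℝ) : ℂ) ^ r / (N : ℂ) ^ p) atTop (𝓝 0) := by
  have h1 : Tendsto (fun N : ℕ => (((√(N : ℝ))⁻¹ ^ (2 * p - r) : ℝ) : ℂ)) atTop (𝓝 0) := by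
    have := (tendsto_inv_atTop_zero.comp tendsto_sqrt_natCast).pow (2 * p - r)
    rw [zero_pow (by omega)] at this
    exact_mod_cast (Complex.continuous_ofReal.tendsto 0).comp this
  refine h1.congr' ?_
  filter_upwards [eventually_gt_atTop 0] with N hN
  have h0 : ((√(N : ℝ) : ℝ) : ℂ) ≠ 0 := by
    exact Complex.ofReal_ne_zero.2 (Real.sqrt_ne_zero'.2 (by exact_mod_cast hN))
  rw [← ofReal_sqrt_sq, ← pow_mul, Complex.ofReal_pow, Complex.ofReal_inv, inv_pow]
  rw [eq_div_iff (pow_ne_zero _ h0), inv_mul_eq_div, div_eq_iff (pow_ne_zero _ h0), ← pow_add]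
  congr 1
  omega

/-- Rescaled truncated Gaussian moments. -/
theorem hasExpansion_gaussian_monomial {c δ : ℝ} (hc : 0 < c) (hδ : 0 < δ) (r j m : ℕ) :
    HasExpansion r fun N => ∫ s in -(√(N : ℝ) * δ)..√(N : ℝ) * δ,
      ((Real.exp (-c * s ^ 2) : ℝ) : ℂ) * (s : ℂ) ^ (2 * j) * ((s / √(N : ℝ) : ℝ) : ℂ) ^ m := by
  set I : ℕ → ℂ := fun N => ∫ s in -(√(N : ℝ) * δ)..√(N : ℝ) * δ,
    ((Real.exp (-c * s ^ 2) : ℝ) : ℂ) * (s : ℂ) ^ (2 * j + m) with hI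
  have hrw : ∀ N : ℕ, ∫ s in -(√(N : ℝ) * δ)..√(N : ℝ) * δ,
      ((Real.exp (-c * s ^ 2) : ℝ) : ℂ) * (s : ℂ) ^ (2 * j) * ((s / √(N : ℝ) : ℝ) : ℂ) ^ m =
      (((√(N : ℝ) : ℝ) : ℂ) ^ m)⁻¹ * I N := by
    intro N
    rw [hI, ← intervalIntegral.integral_const_mul]
    congr 1
    ext s
    rw [Complex.ofReal_div, div_pow, pow_add]
    ring
  simp_rw [hrw]
  -- Parity is why only integer powers of `1 / N` occur: an even `m = 2 p` gives `N ^ (-p)`, while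
  -- an odd `m` makes the integrand odd on a symmetric window.
  rcases Nat.even_or_odd m with ⟨p, hp⟩ | hm
  · set M : ℂ := ∫ s : ℝ, ((Real.exp (-c * s ^ 2) : ℝ) : ℂ) * (s : ℂ) ^ (2 * j + m) with hM
    have hpow : ∀ N : ℕ, ((√(N : ℝ) : ℝ) : ℂ) ^ m = (N : ℂ) ^ p := fun N => by
      rw [hp, ← two_mul, pow_mul, ofReal_sqrt_sq]
    have hmain : HasExpansion r fun N => M / (N : ℂ) ^ p := by
      by_cases hpr : p ≤ r / 2
      · refine ⟨Pi.single p M, tendsto_const_nhds.congr fun N => ?_⟩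
        rw [Finset.sum_eq_single p]
        · simp
        · intro b _ hb
          simp [hb]
        · intro h
          exact absurd (Finset.mem_range.2 (by omega)) h
      · refine .of_tendsto_zero ?_
        have := (tendsto_sqrt_pow_div_natCast_pow (not_le.1 hpr)).const_mul M
        rw [mul_zero] at this
        exact this.congr fun N => by ring
    refine hmain.congr_of_tendsto ?_
    have htail := tendsto_sqrt_pow_mul_gaussian_tail hc hδ r (2 * j + m)
    have hb : IsBoundedUnder (· ≤ ·) atTop fun N : ℕ => ‖((N : ℂ) ^ p)⁻¹‖ := by
      refine isBoundedUnder_of_eventually_le (a := 1) ?_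
      filter_upwards [eventually_ge_atTop 1] with N hN
      rw [norm_inv, norm_pow, Complex.norm_natCast]
      exact inv_le_one_of_one_le₀ (one_le_pow₀ (by exact_mod_cast hN))
    refine (htail.zero_mul_isBoundedUnder_le hb).congr fun N => ?_
    rw [hpow]
    ring
  · refine .of_tendsto_zero (tendsto_const_nhds.congr fun N => ?_)
    have hodd : I N = -I N := by
      conv_lhs => rw [hI]
      simp only
      rw [← neg_neg (√(N : ℝ) * δ), ← intervalIntegral.integral_comp_neg, neg_neg, hI]
      simp only
      rw [← intervalIntegral.integral_neg]
      congr 1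
      ext s
      have : Odd (2 * j + m) := Even.add_odd (even_two_mul j) hm
      rw [Complex.ofReal_neg, this.neg_pow, neg_sq]
      ring
    rw [self_eq_neg.1 hodd]
    simp

open Polynomial in
theorem hasExpansion_gaussian_polynomial {c δ : ℝ} (hc : 0 < c) (hδ : 0 < δ) (r j : ℕ) (q : ℂ[X]) :
    HasExpansion r fun N => ∫ s in -(√(N : ℝ) * δ)..√(N : ℝ) * δ,
      ((Real.exp (-c * s ^ 2) : ℝ) : ℂ) * (s : ℂ) ^ (2 * j) *
        q.eval ((s / √(N : ℝ) : ℝ) : ℂ) := by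
  have h : HasExpansion r fun N => ∑ m ∈ q.support, q.coeff m *
      ∫ s in -(√(N : ℝ) * δ)..√(N : ℝ) * δ,
      ((Real.exp (-c * s ^ 2) : ℝ) : ℂ) * (s : ℂ) ^ (2 * j) * ((s / √(N : ℝ) : ℝ) : ℂ) ^ m :=
    .sum _ fun m _ => (hasExpansion_gaussian_monomial hc hδ r j m).const_mul _
  refine h.congr fun N => ?_
  simp_rw [← intervalIntegral.integral_const_mul]
  rw [← intervalIntegral.integral_finsetSum]
  · congr 1
    ext s
    rw [Polynomial.eval_eq_sum, Polynomial.sum, Finset.mul_sum]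
    exact Finset.sum_congr rfl fun m _ => by ring
  · intro m _
    exact Continuous.intervalIntegrable (by fun_prop) _ _

end Laplace

/-! ### Laplace's method with a complex phase. -/

section LaplaceMain

/-- Pointwise core of Laplace's method, used with `w = √N` and `w t = s`. The series of `exp(w² x)`
is cut at order `r`; its remainder costs at most `exp(c (w t)² / 2)`, which half of the Gaussian
absorbs. The factor `η` serves twice: `η = 1` gives domination, small `η` gives pointwise
convergence. -/
theorem norm_exp_expansion_sub_le {r : ℕ} {x y : ℂ} {R : ℕ → ℂ} {t w c η : ℝ} (hw : 0 ≤ w)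
    (hc : 0 ≤ c) (hη : 0 ≤ η)
    (h1 : ∀ j ≤ r, ‖x ^ j * y - (t : ℂ) ^ (2 * j) * R j‖ ≤ η * |t| ^ (r + 2 * j))
    (h2 : ‖x ^ (r + 1) * y‖ ≤ η * |t| ^ (3 * r + 2)) (h3 : ‖x‖ ≤ c / 2 * t ^ 2) :
    ‖(w : ℂ) ^ r * (y * Complex.exp ((w : ℂ) ^ 2 * (-c * (t : ℂ) ^ 2 + x)) -
      ∑ j ∈ Finset.range (r + 1), ((Real.exp (-c * (w * t) ^ 2) : ℝ) : ℂ) *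
        ((w * t : ℝ) : ℂ) ^ (2 * j) * R j / (j.factorial : ℂ))‖ ≤
    η * (Real.exp (-(c / 2) * (w * t) ^ 2) * (|w * t| ^ (3 * r + 2) +
      ∑ j ∈ Finset.range (r + 1), |w * t| ^ (r + 2 * j))) := by
  have hexp : Complex.exp ((w : ℂ) ^ 2 * (-c * (t : ℂ) ^ 2 + x)) =
      ((Real.exp (-c * (w * t) ^ 2) : ℝ) : ℂ) * Complex.exp ((w : ℂ) ^ 2 * x) := by
    rw [Complex.ofReal_exp, ← Complex.exp_add]
    congr 1
    push_cast
    ring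
  have hsplit : (w : ℂ) ^ r * (y * Complex.exp ((w : ℂ) ^ 2 * (-c * (t : ℂ) ^ 2 + x)) -
      ∑ j ∈ Finset.range (r + 1), ((Real.exp (-c * (w * t) ^ 2) : ℝ) : ℂ) *
        ((w * t : ℝ) : ℂ) ^ (2 * j) * R j / (j.factorial : ℂ)) =
      ((Real.exp (-c * (w * t) ^ 2) : ℝ) : ℂ) * ((w : ℂ) ^ r * y *
        (Complex.exp ((w : ℂ) ^ 2 * x) -
          ∑ j ∈ Finset.range (r + 1), ((w : ℂ) ^ 2 * x) ^ j / (j.factorial : ℂ)) +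
        ∑ j ∈ Finset.range (r + 1), (w : ℂ) ^ (r + 2 * j) *
          (x ^ j * y - (t : ℂ) ^ (2 * j) * R j) / (j.factorial : ℂ)) := by
    rw [hexp]
    simp only [mul_sub, mul_add, Finset.mul_sum, sub_div, Finset.sum_sub_distrib]
    have e1 : ∀ j, (w : ℂ) ^ r * (((Real.exp (-c * (w * t) ^ 2) : ℝ) : ℂ) *
        ((w * t : ℝ) : ℂ) ^ (2 * j) * R j / (j.factorial : ℂ)) =
        ((Real.exp (-c * (w * t) ^ 2) : ℝ) : ℂ) *
        ((w : ℂ) ^ (r + 2 * j) * ((t : ℂ) ^ (2 * j) * R j) / (j.factorial : ℂ)) := by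
      intro j
      push_cast
      ring
    have e2 : ∀ j, ((Real.exp (-c * (w * t) ^ 2) : ℝ) : ℂ) * ((w : ℂ) ^ r * y *
        (((w : ℂ) ^ 2 * x) ^ j / (j.factorial : ℂ))) =
        ((Real.exp (-c * (w * t) ^ 2) : ℝ) : ℂ) *
          ((w : ℂ) ^ (r + 2 * j) * (x ^ j * y) / (j.factorial : ℂ)) := by
      intro j
      ring
    simp only [e1, e2]
    ring
  have hwx : ‖(w : ℂ) ^ 2 * x‖ ≤ c / 2 * (w * t) ^ 2 := by
    rw [norm_mul, norm_pow, Complex.norm_real, Real.norm_of_nonneg hw]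
    calc w ^ 2 * ‖x‖ ≤ w ^ 2 * (c / 2 * t ^ 2) := by gcongr
      _ = _ := by ring
  have hwt : |w * t| = w * |t| := by rw [abs_mul, abs_of_nonneg hw]
  have b1 : ‖(w : ℂ) ^ r * y * (Complex.exp ((w : ℂ) ^ 2 * x) -
      ∑ j ∈ Finset.range (r + 1), ((w : ℂ) ^ 2 * x) ^ j / (j.factorial : ℂ))‖ ≤
      η * (|w * t| ^ (3 * r + 2) * Real.exp (c / 2 * (w * t) ^ 2)) := by
    rw [norm_mul]
    calc _ ≤ ‖(w : ℂ) ^ r * y‖ * (‖(w : ℂ) ^ 2 * x‖ ^ (r + 1) * Real.exp ‖(w : ℂ) ^ 2 * x‖) := by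
          gcongr
          exact Complex.norm_exp_sub_sum_le_norm_mul_exp _ _
      _ = w ^ (3 * r + 2) * ‖x ^ (r + 1) * y‖ * Real.exp ‖(w : ℂ) ^ 2 * x‖ := by
          simp only [norm_mul, norm_pow, Complex.norm_real, Real.norm_of_nonneg hw]
          ring
      _ ≤ w ^ (3 * r + 2) * (η * |t| ^ (3 * r + 2)) * Real.exp (c / 2 * (w * t) ^ 2) := by
          gcongr
      _ = _ := by rw [hwt]; ring
  have b2 : ‖∑ j ∈ Finset.range (r + 1), (w : ℂ) ^ (r + 2 * j) *
      (x ^ j * y - (t : ℂ) ^ (2 * j) * R j) / (j.factorial : ℂ)‖ ≤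
      η * (∑ j ∈ Finset.range (r + 1), |w * t| ^ (r + 2 * j)) := by
    rw [Finset.mul_sum]
    refine (norm_sum_le _ _).trans (Finset.sum_le_sum fun j hj => ?_)
    rw [norm_div, norm_mul, norm_pow, Complex.norm_real, Real.norm_of_nonneg hw,
      Complex.norm_natCast]
    refine (div_le_self (by positivity) (by exact_mod_cast j.factorial_pos)).trans ?_
    calc w ^ (r + 2 * j) * ‖x ^ j * y - (t : ℂ) ^ (2 * j) * R j‖
        ≤ w ^ (r + 2 * j) * (η * |t| ^ (r + 2 * j)) := by
          gcongr
          exact h1 j (by simpa [Nat.lt_succ_iff] using hj)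
      _ = _ := by rw [hwt]; ring
  rw [hsplit, norm_mul, Complex.norm_real, Real.norm_of_nonneg (Real.exp_pos _).le]
  have hE : Real.exp (-c * (w * t) ^ 2) * Real.exp (c / 2 * (w * t) ^ 2) =
      Real.exp (-(c / 2) * (w * t) ^ 2) := by
    rw [← Real.exp_add]; congr 1; ring
  have hE2 : Real.exp (-c * (w * t) ^ 2) ≤ Real.exp (-(c / 2) * (w * t) ^ 2) := by
    rw [Real.exp_le_exp]
    nlinarith [mul_nonneg hc (sq_nonneg (w * t))]
  calc _ ≤ Real.exp (-c * (w * t) ^ 2) *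
        (η * (|w * t| ^ (3 * r + 2) * Real.exp (c / 2 * (w * t) ^ 2)) +
          η * (∑ j ∈ Finset.range (r + 1), |w * t| ^ (r + 2 * j))) := by
        gcongr
        exact (norm_add_le _ _).trans (add_le_add b1 b2)
    _ = η * ((Real.exp (-c * (w * t) ^ 2) * Real.exp (c / 2 * (w * t) ^ 2)) *
          |w * t| ^ (3 * r + 2) + Real.exp (-c * (w * t) ^ 2) *
            ∑ j ∈ Finset.range (r + 1), |w * t| ^ (r + 2 * j)) := by ring
    _ ≤ _ := by
        refine mul_le_mul_of_nonneg_left ?_ hη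
        rw [hE, mul_add]
        gcongr

open Polynomial in
/-- **Laplace's method** with a complex phase: a full asymptotic expansion to order `N ^ (-r/2)`. -/
theorem hasExpansion_laplace {r : ℕ} {c : ℝ} (hc : 0 < c) {ψ G : ℝ → ℂ} {p g : ℂ[X]}
    (hψ : (fun t => ψ t - (t : ℂ) ^ 3 * p.eval (t : ℂ)) =o[𝓝 0] fun t => t ^ (r + 2))
    (hG : (fun t => G t - g.eval (t : ℂ)) =o[𝓝 0] fun t => t ^ r)
    (hψc : ∀ᶠ t in 𝓝 0, ContinuousAt ψ t) (hGc : ∀ᶠ t in 𝓝 0, ContinuousAt G t) :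
    ∀ᶠ δ in 𝓝[>] (0 : ℝ), HasExpansion r fun N => ((√(N : ℝ) : ℝ) : ℂ) *
      ∫ t in -δ..δ, G t * Complex.exp (N * (-c * (t : ℂ) ^ 2 + ψ t)) := by
  -- Since `(t³ p)^j g = t^(2j) (t^j p^j g)`, the factor `t^(2j)` joins `N^j` to form `s^(2j)`, and
  -- the rest is a polynomial in `s / √N`.
  set R : ℕ → ℂ[X] := fun j => X ^ j * p ^ j * g with hR
  have hh := isLittleO_pow_mul_sub hψ hG
  set Good : ℝ → ℝ → Prop := fun η t =>
    (∀ j ≤ r, ‖ψ t ^ j * G t - (t : ℂ) ^ (2 * j) * (R j).eval (t : ℂ)‖ ≤ η * |t| ^ (r + 2 * j)) ∧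
    ‖ψ t ^ (r + 1) * G t‖ ≤ η * |t| ^ (3 * r + 2) with hGood
  have hgood : ∀ η > 0, ∀ᶠ t in 𝓝 0, Good η t := by
    intro η hη
    refine Eventually.and ?_ ?_
    · have : ∀ᶠ t in 𝓝 (0 : ℝ), ∀ j ∈ Finset.range (r + 1),
          ‖ψ t ^ j * G t - (t : ℂ) ^ (2 * j) * (R j).eval (t : ℂ)‖ ≤ η * |t| ^ (r + 2 * j) := by
        rw [Finset.eventually_all]
        intro j _
        filter_upwards [(hh j).1.bound hη] with t ht
        rw [norm_pow, Real.norm_eq_abs] at ht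
        convert ht using 3
        simp only [hR, eval_mul, eval_pow, eval_X]
        ring
      filter_upwards [this] with t ht j hj
      exact ht j (Finset.mem_range.2 (by omega))
    · have h1 : (fun t => ψ t ^ (r + 1)) =o[𝓝 0] fun t => t ^ (3 * r + 2) := by
        have h2 : (fun t : ℝ => ((t : ℂ) ^ 3 * p.eval (t : ℂ)) ^ (r + 1)) =o[𝓝 0]
            fun t => t ^ (3 * r + 2) :=
          (((isBigO_pow_mul_eval 3 p).pow (r + 1)).congr_right fun t => by ring).trans_isLittleO
            (isLittleO_pow_of_lt (by omega : 3 * r + 2 < 3 * (r + 1)))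
        have h3 := (hh (r + 1)).2.1.congr_right (g₂ := fun t => t ^ (3 * r + 2)) fun t => by ring
        simpa using h3.add h2
      have h4 := (h1.mul_isBigO (hh 0).2.2.1)
      simp only [mul_one] at h4
      filter_upwards [h4.bound hη] with t ht
      rwa [norm_pow, Real.norm_eq_abs] at ht
  have hψ2 : ∀ᶠ t in 𝓝 0, ‖ψ t‖ ≤ c / 2 * t ^ 2 := by
    filter_upwards [(hh 0).2.2.2.bound (half_pos hc)] with t ht
    simpa using ht
  obtain ⟨δ₀, hδ₀, hball⟩ := Metric.eventually_nhds_iff.1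
    ((hgood 1 one_pos).and (hψ2.and (hψc.and hGc)))
  filter_upwards [Ioo_mem_nhdsGT hδ₀] with δ hδ
  have hδ0 : 0 < δ := hδ.1
  have hball' : ∀ t : ℝ, |t| ≤ δ → Good 1 t ∧ ‖ψ t‖ ≤ c / 2 * t ^ 2 ∧ ContinuousAt ψ t ∧
      ContinuousAt G t := fun t ht =>
    hball (by rw [dist_zero_right, Real.norm_eq_abs]; exact ht.trans_lt hδ.2)
  set main : ℕ → ℝ → ℂ := fun N s => ∑ j ∈ Finset.range (r + 1),
    ((Real.exp (-c * s ^ 2) : ℝ) : ℂ) * (s : ℂ) ^ (2 * j) *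
      (R j).eval ((s / √(N : ℝ) : ℝ) : ℂ) / (j.factorial : ℂ) with hmain
  have hmainexp : HasExpansion r fun N => ∫ s in -(√(N : ℝ) * δ)..√(N : ℝ) * δ, main N s := by
    have h : HasExpansion r fun N => ∑ j ∈ Finset.range (r + 1), (j.factorial : ℂ)⁻¹ *
        ∫ s in -(√(N : ℝ) * δ)..√(N : ℝ) * δ, ((Real.exp (-c * s ^ 2) : ℝ) : ℂ) *
          (s : ℂ) ^ (2 * j) * (R j).eval ((s / √(N : ℝ) : ℝ) : ℂ) :=
      .sum _ fun j _ => (hasExpansion_gaussian_polynomial hc hδ0 r j (R j)).const_mul _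
    refine h.congr fun N => ?_
    simp_rw [← intervalIntegral.integral_const_mul]
    rw [← intervalIntegral.integral_finsetSum]
    · congr 1
      ext s
      exact Finset.sum_congr rfl fun j _ => by ring
    · intro j _
      exact Continuous.intervalIntegrable (by fun_prop) _ _
  refine hmainexp.congr_of_tendsto ?_
  set f : ℕ → ℝ → ℂ := fun N s => G (s / √(N : ℝ)) * Complex.exp (((√(N : ℝ) : ℝ) : ℂ) ^ 2 *
    (-c * ((s / √(N : ℝ) : ℝ) : ℂ) ^ 2 + ψ (s / √(N : ℝ)))) with hf
  set H : ℝ → ℝ := fun s => Real.exp (-(c / 2) * s ^ 2) * (|s| ^ (3 * r + 2) +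
      ∑ j ∈ Finset.range (r + 1), |s| ^ (r + 2 * j)) with hH
  have hHi : Integrable H := by
    simp only [hH, mul_add, Finset.mul_sum]
    exact (integrable_exp_neg_mul_sq_mul_abs_pow (half_pos hc) _).add
      (integrable_finsetSum _ fun j _ => integrable_exp_neg_mul_sq_mul_abs_pow (half_pos hc) _)
  set S : ℕ → Set ℝ := fun N => Set.Ioc (-(√(N : ℝ) * δ)) (√(N : ℝ) * δ) with hS
  have hbound : ∀ (N : ℕ) (s η : ℝ), 1 ≤ N → 0 ≤ η → Good η (s / √(N : ℝ)) →
      ‖ψ (s / √(N : ℝ))‖ ≤ c / 2 * (s / √(N : ℝ)) ^ 2 →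
      ‖((√(N : ℝ) : ℝ) : ℂ) ^ r * (f N s - main N s)‖ ≤ η * H s := by
    intro N s η hN hη hg h3
    have hw : √(N : ℝ) * (s / √(N : ℝ)) = s :=
      mul_div_cancel₀ _ (Real.sqrt_ne_zero'.2 (by exact_mod_cast hN))
    have := norm_exp_expansion_sub_le (R := fun j => (R j).eval ((s / √(N : ℝ) : ℝ) : ℂ))
      (Real.sqrt_nonneg (N : ℝ)) hc.le hη hg.1 hg.2 h3
    rwa [hw] at this
  have hmem : ∀ (N : ℕ) (s : ℝ), 1 ≤ N → s ∈ S N → |s / √(N : ℝ)| ≤ δ := by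
    intro N s hN hs
    have hw : 0 < √(N : ℝ) := Real.sqrt_pos.2 (by exact_mod_cast hN)
    rw [abs_div, abs_of_pos hw, div_le_iff₀ hw, mul_comm]
    exact abs_le.2 ⟨hs.1.le, hs.2⟩
  have hfcont : ∀ N : ℕ, 1 ≤ N → ContinuousOn (f N) (Set.Icc (-(√(N : ℝ) * δ)) (√(N : ℝ) * δ)) := by
    intro N hN s hs
    have hw : 0 < √(N : ℝ) := Real.sqrt_pos.2 (by exact_mod_cast hN)
    have hle : |s / √(N : ℝ)| ≤ δ := by
      rw [abs_div, abs_of_pos hw, div_le_iff₀ hw, mul_comm]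
      exact abs_le.2 hs
    have hd : ContinuousAt (fun s : ℝ => s / √(N : ℝ)) s := by fun_prop
    have h1 : ContinuousAt (fun s => G (s / √(N : ℝ))) s :=
      ContinuousAt.comp (g := G) (hball' _ hle).2.2.2 hd
    have h2 : ContinuousAt (fun s => ψ (s / √(N : ℝ))) s :=
      ContinuousAt.comp (g := ψ) (hball' _ hle).2.2.1 hd
    have h3 : ContinuousAt (fun s => ((s / √(N : ℝ) : ℝ) : ℂ)) s :=
      ContinuousAt.comp Complex.continuous_ofReal.continuousAt hd
    exact (h1.mul (continuousAt_const.mul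
      ((continuousAt_const.mul (h3.pow 2)).add h2)).cexp).continuousWithinAt
  have hmaincont : ∀ N, Continuous (main N) := fun N => by fun_prop
  have hrw : ∀ N : ℕ, 1 ≤ N → ((√(N : ℝ) : ℝ) : ℂ) ^ r * (((√(N : ℝ) : ℝ) : ℂ) *
      (∫ t in -δ..δ, G t * Complex.exp (N * (-c * (t : ℂ) ^ 2 + ψ t))) -
      ∫ s in -(√(N : ℝ) * δ)..√(N : ℝ) * δ, main N s) =
      ∫ s, (S N).indicator (fun s => ((√(N : ℝ) : ℝ) : ℂ) ^ r * (f N s - main N s)) s := by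
    intro N hN
    have hw : √(N : ℝ) ≠ 0 := Real.sqrt_ne_zero'.2 (by exact_mod_cast hN)
    have h0 : 0 ≤ √(N : ℝ) * δ := by positivity
    have hsub : ((√(N : ℝ) : ℝ) : ℂ) *
        (∫ t in -δ..δ, G t * Complex.exp (N * (-c * (t : ℂ) ^ 2 + ψ t))) =
        ∫ s in -(√(N : ℝ) * δ)..√(N : ℝ) * δ, f N s := by
      have := intervalIntegral.smul_integral_comp_mul_left (a := -δ) (b := δ) (f N) (√(N : ℝ))
      rw [mul_neg] at this
      rw [← this, Complex.real_smul]
      congr 1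
      congr 1
      ext t
      simp only [hf]
      rw [mul_div_cancel_left₀ _ hw, ofReal_sqrt_sq]
    have hi : IntervalIntegrable (f N) volume (-(√(N : ℝ) * δ)) (√(N : ℝ) * δ) := by
      refine ContinuousOn.intervalIntegrable ?_
      rw [Set.uIcc_of_le (by linarith)]
      exact hfcont N hN
    rw [integral_indicator measurableSet_Ioc, hsub, ← intervalIntegral.integral_sub hi
      ((hmaincont N).intervalIntegrable _ _), ← intervalIntegral.integral_const_mul,
      intervalIntegral.integral_of_le (by linarith)]
  have hlim : Tendsto (fun N : ℕ => ∫ s, (S N).indicator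
      (fun s => ((√(N : ℝ) : ℝ) : ℂ) ^ r * (f N s - main N s)) s) atTop (𝓝 (∫ _ : ℝ, (0 : ℂ))) := by
    -- On the window the estimate holds with `η = 1`. For fixed `s`, `s / √N → 0` makes every `η >
    -- 0` eventually admissible.
    refine tendsto_integral_filter_of_dominated_convergence H ?_ ?_ hHi ?_
    · filter_upwards [eventually_ge_atTop 1] with N hN
      rw [aestronglyMeasurable_indicator_iff measurableSet_Ioc]
      refine ContinuousOn.aestronglyMeasurable ?_ measurableSet_Ioc
      exact (continuousOn_const.mul (((hfcont N hN).mono Set.Ioc_subset_Icc_self).sub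
        (hmaincont N).continuousOn))
    · filter_upwards [eventually_ge_atTop 1] with N hN
      refine Eventually.of_forall fun s => ?_
      by_cases hs : s ∈ S N
      · rw [Set.indicator_of_mem hs]
        have h := hball' _ (hmem N s hN hs)
        simpa using hbound N s 1 hN zero_le_one h.1 h.2.1
      · rw [Set.indicator_of_notMem hs, norm_zero]
        positivity
    · refine Eventually.of_forall fun s => ?_
      rw [Metric.tendsto_nhds]
      intro ε hε
      have hH0 : 0 ≤ H s := by positivity
      set η := ε / (H s + 1) / 2 with hη
      have hη0 : 0 < η := by positivity
      have hηH : η * H s < ε := by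
        rw [hη, div_div, div_mul_eq_mul_div, div_lt_iff₀ (by positivity)]
        nlinarith
      have ht : Tendsto (fun N : ℕ => s / √(N : ℝ)) atTop (𝓝 0) :=
        tendsto_sqrt_natCast.const_div_atTop s
      filter_upwards [ht.eventually ((hgood η hη0).and hψ2), eventually_ge_atTop 1] with N h1 hN
      rw [dist_zero_right]
      refine lt_of_le_of_lt ?_ hηH
      exact (norm_indicator_le_norm_self _ _).trans (hbound N s η hN hη0.le h1.1 h1.2)
  rw [integral_zero] at hlim
  refine hlim.congr' ?_
  filter_upwards [eventually_ge_atTop 1] with N hN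
  exact (hrw N hN).symm

end LaplaceMain

/-! ### Fourier estimates for the test functions. -/

section FourierSide

open scoped FourierTransform in
theorem fourier_div_two_pi (f : ℝ → ℂ) (t : ℝ) :
    𝓕 f (t / (2 * Real.pi)) = ∫ x : ℝ, Complex.exp (-(Complex.I * t * x)) * f x := by
  rw [Real.fourier_real_eq_integral_exp_smul]
  congr 1
  ext x
  rw [smul_eq_mul]
  congr 2
  have : (Real.pi : ℂ) ≠ 0 := by exact_mod_cast Real.pi_ne_zero
  push_cast
  field_simp

/-- The Fourier transform in the angular-frequency normalisation. -/
noncomputable def fhat (f : ℝ → ℂ) (t : ℝ) : ℂ := ∫ x : ℝ, Complex.exp (-(Complex.I * t * x)) * f x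

variable {m k : ℕ} {f : ℝ → ℂ}

theorem eLpNorm_iteratedDeriv_le (j : ℕ) (hj : j ≤ m) :
    eLpNorm (iteratedDeriv j f) 1 volume ≤ mixedNorm m k f :=
  (Finset.le_sup (f := fun j => eLpNorm (iteratedDeriv j f) 1 volume)
    (Finset.mem_range.2 (by omega))).trans le_self_add

theorem eLpNorm_pow_mul_le (j : ℕ) (hj : j ≤ k) :
    eLpNorm (fun x : ℝ => (x : ℂ) ^ j * f x) 1 volume ≤ mixedNorm m k f :=
  (Finset.le_sup (f := fun j => eLpNorm (fun x : ℝ => (x : ℂ) ^ j * f x) 1 volume)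
    (Finset.mem_range.2 (by omega))).trans le_add_self

theorem integrable_and_integral_norm_le {g : ℝ → ℂ} (hg : Continuous g)
    (hfin : mixedNorm m k f < ∞) (h : eLpNorm g 1 volume ≤ mixedNorm m k f) :
    Integrable g ∧ ∫ x, ‖g x‖ ≤ (mixedNorm m k f).toReal := by
  have hi : Integrable g := memLp_one_iff_integrable.1
    ⟨hg.aestronglyMeasurable, h.trans_lt hfin⟩
  refine ⟨hi, ?_⟩
  rw [eLpNorm_one_eq_lintegral_enorm, ← ofReal_integral_norm_eq_lintegral_enorm hi] at h
  exact (ENNReal.ofReal_le_iff_le_toReal hfin.ne).1 h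

theorem iteratedDeriv_bounds (hf : f ∈ functionSpace m k) {j : ℕ} (hj : j ≤ m) :
    Integrable (iteratedDeriv j f) ∧
      ∫ x, ‖iteratedDeriv j f x‖ ≤ (mixedNorm m k f).toReal :=
  integrable_and_integral_norm_le (hf.1.continuous_iteratedDeriv j (by exact_mod_cast hj)) hf.2
    (eLpNorm_iteratedDeriv_le j hj)

theorem moment_bounds (hf : f ∈ functionSpace m k) {j : ℕ} (hj : j ≤ k) :
    Integrable (fun x : ℝ => (x : ℂ) ^ j * f x) ∧
      ∫ x : ℝ, ‖(x : ℂ) ^ j * f x‖ ≤ (mixedNorm m k f).toReal := by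
  have hfc := hf.1.continuous
  exact integrable_and_integral_norm_le (by fun_prop) hf.2 (eLpNorm_pow_mul_le j hj)

theorem integrable_of_mem_functionSpace (hf : f ∈ functionSpace m k) : Integrable f := by
  simpa using (iteratedDeriv_bounds hf (Nat.zero_le m)).1

-- Up to a factor of modulus one, `t^j f̂(t)` is the transform of the `j`-th derivative, which is
-- bounded by its `L¹` norm.
open scoped FourierTransform in
theorem abs_pow_mul_norm_fhat_le (hf : f ∈ functionSpace m k) {j : ℕ} (hj : j ≤ m) (t : ℝ) :
    |t| ^ j * ‖fhat f t‖ ≤ (mixedNorm m k f).toReal := by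
  refine le_trans ?_ (iteratedDeriv_bounds hf hj).2
  have h := congrFun (Real.fourier_iteratedDeriv (N := m) (n := j) hf.1
    (fun n hn => (iteratedDeriv_bounds hf (by exact_mod_cast hn)).1) (by exact_mod_cast hj))
    (t / (2 * Real.pi))
  rw [fourier_div_two_pi, fourier_div_two_pi] at h
  have h2 : ‖∫ x : ℝ, Complex.exp (-(Complex.I * t * x)) * iteratedDeriv j f x‖ ≤
      ∫ x, ‖iteratedDeriv j f x‖ := by
    refine (norm_integral_le_integral_norm _).trans (le_of_eq ?_)
    congr 1
    ext x
    rw [norm_mul, show -(Complex.I * t * x) = ((-(t * x) : ℝ) : ℂ) * Complex.I by push_cast; ring,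
      Complex.norm_exp_ofReal_mul_I, one_mul]
  rw [h, norm_smul, norm_pow] at h2
  have h3 : ‖2 * (Real.pi : ℂ) * Complex.I * ((t / (2 * Real.pi) : ℝ) : ℂ)‖ = |t| := by
    have : (Real.pi : ℂ) ≠ 0 := by exact_mod_cast Real.pi_ne_zero
    rw [show 2 * (Real.pi : ℂ) * Complex.I * ((t / (2 * Real.pi) : ℝ) : ℂ) = t * Complex.I by
      push_cast; field_simp]
    simp
  rw [h3] at h2
  exact h2

theorem norm_fhat_le (hf : f ∈ functionSpace m k) (hm : 2 ≤ m) (t : ℝ) :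
    ‖fhat f t‖ ≤ 2 * (mixedNorm m k f).toReal * (1 + t ^ 2)⁻¹ := by
  have h0 := abs_pow_mul_norm_fhat_le hf (Nat.zero_le m) t
  have h2 := abs_pow_mul_norm_fhat_le hf hm t
  rw [sq_abs] at h2
  rw [← div_eq_mul_inv, le_div_iff₀ (by positivity)]
  linarith

/-- Decay of the Fourier transform at high frequencies, gaining `T ^ (-q)` for `|t| ≥ T ≥ 1`. -/
theorem norm_fhat_le_of_le_abs {q : ℕ} (hf : f ∈ functionSpace (q + 2) k) {T t : ℝ} (hT : 1 ≤ T)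
    (ht : T ≤ |t|) :
    ‖fhat f t‖ ≤ 2 * (mixedNorm (q + 2) k f).toReal * (1 + t ^ 2)⁻¹ * (T ^ q)⁻¹ := by
  have h2 := abs_pow_mul_norm_fhat_le hf le_rfl t
  rw [← div_eq_mul_inv, ← div_eq_mul_inv, le_div_iff₀ (by positivity),
    le_div_iff₀ (by positivity)]
  have h3 : T ^ q * (1 + t ^ 2) ≤ 2 * |t| ^ (q + 2) := by
    have h4 : 1 + t ^ 2 ≤ 2 * |t| ^ 2 := by
      have : 1 ≤ |t| ^ 2 := one_le_pow₀ (hT.trans ht)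
      rw [← sq_abs t]
      linarith
    calc T ^ q * (1 + t ^ 2) ≤ |t| ^ q * (2 * |t| ^ 2) := by gcongr
      _ = _ := by ring
  calc ‖fhat f t‖ * T ^ q * (1 + t ^ 2) = (T ^ q * (1 + t ^ 2)) * ‖fhat f t‖ := by ring
    _ ≤ 2 * |t| ^ (q + 2) * ‖fhat f t‖ := by gcongr
    _ ≤ _ := by linarith

theorem continuous_fhat (hf : Integrable f) : Continuous (fhat f) := by
  refine continuous_of_dominated (bound := fun x => ‖f x‖) (fun t => ?_) (fun t => ?_) hf.norm ?_
  · exact (Continuous.aestronglyMeasurable (by fun_prop)).mul hf.1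
  · refine Eventually.of_forall fun x => ?_
    rw [norm_mul, show -(Complex.I * t * x) = ((-(t * x) : ℝ) : ℂ) * Complex.I by push_cast; ring,
      Complex.norm_exp_ofReal_mul_I, one_mul]
  · refine Eventually.of_forall fun x => ?_
    fun_prop

theorem integrable_fhat (hf : f ∈ functionSpace m k) (hm : 2 ≤ m) : Integrable (fhat f) :=
  (integrable_inv_one_add_sq.const_mul (2 * (mixedNorm m k f).toReal)).mono'
    (continuous_fhat (integrable_of_mem_functionSpace hf)).aestronglyMeasurable
    (Eventually.of_forall fun t => norm_fhat_le hf hm t)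

theorem integral_norm_fhat_le (hf : f ∈ functionSpace m k) (hm : 2 ≤ m) :
    ∫ t, ‖fhat f t‖ ≤ 2 * Real.pi * (mixedNorm m k f).toReal := by
  calc ∫ t, ‖fhat f t‖ ≤ ∫ t : ℝ, 2 * (mixedNorm m k f).toReal * (1 + t ^ 2)⁻¹ :=
        integral_mono (integrable_fhat hf hm).norm (integrable_inv_one_add_sq.const_mul _)
          fun t => norm_fhat_le hf hm t
    _ = _ := by rw [integral_const_mul, integral_univ_inv_one_add_sq]; ring

-- Two integrable derivatives make the transform integrable, and continuity of `f` gives inversion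
-- at every point, not merely almost everywhere. This matters because the law of `S_N` may have
-- atoms.
open scoped FourierTransform in
theorem eq_integral_fhat (hf : f ∈ functionSpace m k) (hm : 2 ≤ m) (x : ℝ) :
    f x = (2 * (Real.pi : ℂ))⁻¹ * ∫ t, fhat f t * Complex.exp (Complex.I * t * x) := by
  have hpi : 2 * Real.pi ≠ 0 := by positivity
  have hfh : ∀ w : ℝ, 𝓕 f w = fhat f (2 * Real.pi * w) := fun w => by
    have := fourier_div_two_pi f (2 * Real.pi * w)
    rwa [mul_div_cancel_left₀ _ hpi] at this
  have hi : Integrable (𝓕 f) := by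
    have := (integrable_fhat hf hm).comp_mul_left' hpi
    exact this.congr (Eventually.of_forall fun w => (hfh w).symm)
  have h := congrFun (hf.1.continuous.fourierInv_fourier_eq (integrable_of_mem_functionSpace hf) hi) x
  rw [← h, Real.fourierInv_eq']
  have h2 := Measure.integral_comp_mul_left
    (fun t : ℝ => fhat f t * Complex.exp (Complex.I * t * x)) (2 * Real.pi)
  rw [abs_of_nonneg (by positivity), Complex.real_smul] at h2
  push_cast at h2
  rw [← h2]
  congr 1
  ext w
  rw [hfh, smul_eq_mul, mul_comm]
  congr 2
  simp only [RCLike.inner_apply, conj_trivial]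
  push_cast
  ring

theorem norm_le_of_mem_functionSpace (hf : f ∈ functionSpace m k) (hm : 2 ≤ m) (x : ℝ) :
    ‖f x‖ ≤ (mixedNorm m k f).toReal := by
  rw [eq_integral_fhat hf hm x, norm_mul]
  have h1 : ‖∫ t, fhat f t * Complex.exp (Complex.I * t * x)‖ ≤ ∫ t, ‖fhat f t‖ := by
    refine (norm_integral_le_integral_norm _).trans (le_of_eq ?_)
    congr 1
    ext t
    rw [norm_mul, show Complex.I * t * x = ((t * x : ℝ) : ℂ) * Complex.I by push_cast; ring,
      Complex.norm_exp_ofReal_mul_I, mul_one]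
  have h2 := h1.trans (integral_norm_fhat_le hf hm)
  have h3 : ‖(2 * (Real.pi : ℂ))⁻¹‖ = (2 * Real.pi)⁻¹ := by
    rw [norm_inv, norm_mul, Complex.norm_real, Real.norm_of_nonneg Real.pi_pos.le]; simp
  rw [h3, inv_mul_le_iff₀ (by positivity)]
  exact h2

/-- For `|y| ≤ 1` the remainder is at most `e |y|^n`. For `|y| ≥ 1` every term is dominated by
`|y|^n`, at total cost `1 + e ≤ 4`. -/
theorem norm_exp_I_sub_sum_le (y : ℝ) (n : ℕ) :
    ‖Complex.exp (-(Complex.I * y)) -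
      ∑ j ∈ Finset.range n, (-(Complex.I * y)) ^ j / (j.factorial : ℂ)‖ ≤ 4 * |y| ^ n := by
  have hny : ‖-(Complex.I * (y : ℂ))‖ = |y| := by simp
  rcases le_total |y| 1 with h | h
  · refine (Complex.norm_exp_sub_sum_le_norm_mul_exp _ n).trans ?_
    rw [hny, mul_comm]
    have : Real.exp |y| ≤ 4 := by
      have := (Real.exp_le_exp.2 h).trans Real.exp_one_lt_d9.le
      linarith
    gcongr
  · have h1 : ‖Complex.exp (-(Complex.I * y))‖ ≤ |y| ^ n := by
      rw [show -(Complex.I * (y : ℂ)) = ((-y : ℝ) : ℂ) * Complex.I by push_cast; ring,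
        Complex.norm_exp_ofReal_mul_I]
      exact one_le_pow₀ h
    have h2 : ‖∑ j ∈ Finset.range n, (-(Complex.I * (y : ℂ))) ^ j / (j.factorial : ℂ)‖ ≤
        3 * |y| ^ n := by
      calc _ ≤ ∑ j ∈ Finset.range n, |y| ^ n * (1 ^ j / (j.factorial : ℝ)) := by
            refine (norm_sum_le _ _).trans (Finset.sum_le_sum fun j hj => ?_)
            rw [norm_div, norm_pow, hny, Complex.norm_natCast, one_pow, ← div_eq_mul_one_div]
            gcongr
            exact (Finset.mem_range.1 hj).le
        _ ≤ |y| ^ n * Real.exp 1 := by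
            rw [← Finset.mul_sum]
            gcongr
            exact Real.sum_le_exp_of_nonneg zero_le_one n
        _ ≤ _ := by
            rw [mul_comm]
            gcongr
            exact Real.exp_one_lt_d9.le.trans (by norm_num)
    refine (norm_sub_le _ _).trans ?_
    linarith

/-- The Taylor coefficients of the transform at `0` are moments of `f`. Expanding the kernel under
the integral gives an error linear in the norm of `f`. -/
theorem norm_fhat_sub_sum_le {r : ℕ} (hf : f ∈ functionSpace m (r + 1)) (t : ℝ) :
    ‖fhat f t - ∑ j ∈ Finset.range (r + 1), (-(Complex.I * t)) ^ j / (j.factorial : ℂ) *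
      ∫ x : ℝ, (x : ℂ) ^ j * f x‖ ≤ 4 * |t| ^ (r + 1) * (mixedNorm m (r + 1) f).toReal := by
  have hfi := integrable_of_mem_functionSpace hf
  have hi : Integrable fun x : ℝ => Complex.exp (-(Complex.I * t * x)) * f x := by
    refine hfi.bdd_mul (c := 1) (Continuous.aestronglyMeasurable (by fun_prop)) ?_
    refine Eventually.of_forall fun x => ?_
    rw [show -(Complex.I * t * x) = ((-(t * x) : ℝ) : ℂ) * Complex.I by push_cast; ring,
      Complex.norm_exp_ofReal_mul_I]
  have hj : ∀ j ∈ Finset.range (r + 1), Integrable fun x : ℝ =>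
      (-(Complex.I * t)) ^ j / (j.factorial : ℂ) * ((x : ℂ) ^ j * f x) := fun j hj =>
    (moment_bounds hf (Finset.mem_range.1 hj).le).1.const_mul _
  have hrw : fhat f t - ∑ j ∈ Finset.range (r + 1), (-(Complex.I * t)) ^ j / (j.factorial : ℂ) *
      ∫ x : ℝ, (x : ℂ) ^ j * f x = ∫ x : ℝ, (Complex.exp (-(Complex.I * (t * x : ℝ))) -
      ∑ j ∈ Finset.range (r + 1), (-(Complex.I * (t * x : ℝ))) ^ j / (j.factorial : ℂ)) * f x := by
    simp_rw [← integral_const_mul]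
    rw [← integral_finsetSum _ hj, fhat, ← integral_sub hi (integrable_finsetSum _ hj)]
    congr 1
    ext x
    rw [sub_mul, Finset.sum_mul]
    congr 1
    · push_cast
      rw [mul_assoc]
    · refine Finset.sum_congr rfl fun j _ => ?_
      push_cast
      ring
  have hlast := moment_bounds hf (le_refl (r + 1))
  rw [hrw]
  calc _ ≤ ∫ x : ℝ, 4 * |t| ^ (r + 1) * ‖(x : ℂ) ^ (r + 1) * f x‖ := by
        refine norm_integral_le_of_norm_le (hlast.1.norm.const_mul _)
          (Eventually.of_forall fun x => ?_)
        rw [norm_mul]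
        calc _ ≤ 4 * |t * x| ^ (r + 1) * ‖f x‖ := by
              gcongr
              exact norm_exp_I_sub_sum_le (t * x) (r + 1)
          _ = _ := by
              rw [norm_mul, norm_pow, Complex.norm_real, Real.norm_eq_abs, abs_mul, mul_pow]
              ring
    _ ≤ _ := by
        rw [integral_const_mul]
        gcongr
        exact hlast.2

variable {Ω : Type*} [MeasurableSpace Ω] {P : Measure Ω} [IsProbabilityMeasure P]

theorem integral_comp_eq_integral_fhat (hf : f ∈ functionSpace m k) (hm : 2 ≤ m) {Y : Ω → ℝ}
    (hY : Measurable Y) :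
    ∫ ω, f (Y ω) ∂P = (2 * (Real.pi : ℂ))⁻¹ *
      ∫ t : ℝ, fhat f t * ∫ ω, Complex.exp (Complex.I * t * Y ω) ∂P := by
  simp_rw [eq_integral_fhat hf hm (Y _), integral_const_mul, ← integral_const_mul (fhat f _)]
  congr 1
  rw [integral_integral_swap]
  have h1 : Integrable (fun p : Ω × ℝ => fhat f p.2) (P.prod volume) :=
    (integrable_fhat hf hm).comp_snd P
  refine h1.mul_bdd (c := 1) ?_ (Eventually.of_forall fun p => ?_)
  · refine Measurable.aestronglyMeasurable ?_
    fun_prop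
  · rw [show Complex.I * p.2 * Y p.1 = ((p.2 * Y p.1 : ℝ) : ℂ) * Complex.I by push_cast; ring,
      Complex.norm_exp_ofReal_mul_I]

end FourierSide

/-! ### Reduction of the Edgeworth expansion to estimates on the characteristic function. -/

section Assembly

/-- Taking real parts of the coefficients of a real sequence can only decrease the error. -/
theorem HasExpansion.exists_real {r : ℕ} {a : ℕ → ℂ} (ha : HasExpansion r a)
    (hreal : ∀ N, (starRingEnd ℂ) (a N) = a N) :
    ∃ β : ℕ → ℝ, Tendsto (fun N : ℕ => √(N : ℝ) ^ r *
      ‖a N - ∑ p ∈ Finset.range (r / 2 + 1), (β p : ℂ) / (N : ℂ) ^ p‖) atTop (𝓝 0) := by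
  obtain ⟨β, hβ⟩ := ha
  refine ⟨fun p => (β p).re, ?_⟩
  have hβ' := hβ.norm
  rw [norm_zero] at hβ'
  refine squeeze_zero (fun N => by positivity) (fun N => ?_) hβ'
  rw [norm_mul, norm_pow, Complex.norm_real, Real.norm_of_nonneg (Real.sqrt_nonneg _)]
  gcongr
  have : a N - ∑ p ∈ Finset.range (r / 2 + 1), ((β p).re : ℂ) / (N : ℂ) ^ p =
      (((a N - ∑ p ∈ Finset.range (r / 2 + 1), β p / (N : ℂ) ^ p).re : ℝ) : ℂ) := by
    rw [Complex.sub_re, Complex.re_sum, Complex.ofReal_sub, Complex.conj_eq_iff_re.1 (hreal N),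
      Complex.ofReal_sum]
    congr 1
    refine Finset.sum_congr rfl fun p _ => ?_
    rw [← Complex.ofReal_natCast, ← Complex.ofReal_pow, Complex.div_ofReal_re, Complex.ofReal_div]
  rw [this, Complex.norm_real, Real.norm_eq_abs]
  exact Complex.abs_re_le_norm _

variable {Ω : Type*} [MeasurableSpace Ω] (P : Measure Ω)

/-- The characteristic function of the centred sum `S_N - N A`. -/
noncomputable def centeredCharFun (S : ℕ → Ω → ℝ) (A : ℝ) (N : ℕ) (t : ℝ) : ℂ :=
  ∫ ω, Complex.exp (Complex.I * t * ((S N ω - N * A : ℝ) : ℂ)) ∂P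

theorem norm_exp_I_mul_mul (t x : ℝ) : ‖Complex.exp (Complex.I * t * (x : ℂ))‖ = 1 := by
  rw [show Complex.I * t * x = ((t * x : ℝ) : ℂ) * Complex.I by push_cast; ring,
    Complex.norm_exp_ofReal_mul_I]

variable [IsProbabilityMeasure P] {S : ℕ → Ω → ℝ} (A : ℝ)

theorem norm_centeredCharFun_le (N : ℕ) (t : ℝ) : ‖centeredCharFun P S A N t‖ ≤ 1 := by
  refine (norm_integral_le_integral_norm _).trans ?_
  simp only [norm_exp_I_mul_mul]
  simp

theorem continuous_centeredCharFun (hS : ∀ N, Measurable (S N)) (N : ℕ) :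
    Continuous (centeredCharFun P S A N) := by
  have := hS N
  refine continuous_of_dominated (bound := fun _ => 1) (fun t => ?_) (fun t => ?_)
    (integrable_const _) ?_
  · exact Measurable.aestronglyMeasurable (by fun_prop)
  · exact Eventually.of_forall fun ω => (norm_exp_I_mul_mul _ _).le
  · exact Eventually.of_forall fun ω => by fun_prop

omit [IsProbabilityMeasure P] in
theorem conj_centeredCharFun (N : ℕ) (t : ℝ) :
    (starRingEnd ℂ) (centeredCharFun P S A N t) = centeredCharFun P S A N (-t) := by
  rw [centeredCharFun, centeredCharFun, ← integral_conj]
  congr 1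
  ext ω
  rw [← Complex.exp_conj]
  simp

/-- The inversion integral is cut at `|t| = δ`. Inside, the Taylor polynomial of the transform is
integrated by `H1` and its remainder by `H2`; outside, `H3` applies. All three are free of `f` apart
from its norm and moments. -/
theorem weakLocalEdgeworth_of_expansion {q r : ℕ} (hS : ∀ N, Measurable (S N)) {δ : ℝ} (hδ : 0 < δ)
    (H1 : ∀ k ≤ r, HasExpansion r fun N => ((√(N : ℝ) : ℝ) : ℂ) *
      ∫ t in -δ..δ, (t : ℂ) ^ k * centeredCharFun P S A N t)
    (H2 : Tendsto (fun N : ℕ => √(N : ℝ) ^ r * (√(N : ℝ) *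
      ∫ t in -δ..δ, |t| ^ (r + 1) * ‖centeredCharFun P S A N t‖)) atTop (𝓝 0))
    {b : ℕ → ℝ} (hb : Tendsto (fun N : ℕ => √(N : ℝ) ^ r * (√(N : ℝ) * b N)) atTop (𝓝 0))
    (H3 : ∀ᶠ N in atTop, ∀ f ∈ functionSpace (q + 2) (r + 1), ∀ t : ℝ, δ ≤ |t| →
      ‖fhat f t‖ * ‖centeredCharFun P S A N t‖ ≤
        (mixedNorm (q + 2) (r + 1) f).toReal * b N * (1 + t ^ 2)⁻¹) :
    WeakLocalEdgeworth P S A r (functionSpace (q + 2) (r + 1))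
      (fun f => (mixedNorm (q + 2) (r + 1) f).toReal) := by
  classical
  set φ := centeredCharFun P S A with hφ
  have hφc : ∀ N, Continuous (φ N) := continuous_centeredCharFun P A hS
  -- real expansion coefficients
  set a : ℕ → ℕ → ℂ := fun k N => ((√(N : ℝ) : ℝ) : ℂ) *
    ∫ t in -δ..δ, (-(Complex.I * t)) ^ k * φ N t with ha
  have hareal : ∀ k N, (starRingEnd ℂ) (a k N) = a k N := by
    intro k N
    simp only [ha, map_mul, Complex.conj_ofReal]
    congr 1
    have hconj : (starRingEnd ℂ) (∫ t in -δ..δ, (-(Complex.I * t)) ^ k * φ N t) =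
        ∫ t in -δ..δ, (starRingEnd ℂ) ((-(Complex.I * t)) ^ k * φ N t) := by
      rw [intervalIntegral.integral_of_le (by linarith), ← integral_conj,
        ← intervalIntegral.integral_of_le (by linarith)]
    rw [hconj]
    have := intervalIntegral.integral_comp_neg (a := -δ) (b := δ)
      (fun t : ℝ => (-(Complex.I * t)) ^ k * φ N t)
    rw [neg_neg] at this
    rw [← this]
    congr 1
    ext t
    simp only [map_mul, map_pow, map_neg, Complex.conj_I, Complex.conj_ofReal, hφ,
      conj_centeredCharFun, Complex.ofReal_neg, mul_neg, neg_mul]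
  have haexp : ∀ k ≤ r, HasExpansion r (a k) := by
    intro k hk
    refine ((H1 k hk).const_mul ((-Complex.I) ^ k)).congr fun N => ?_
    rw [ha]
    simp only
    rw [mul_left_comm, ← intervalIntegral.integral_const_mul]
    congr 2
    ext t
    rw [← mul_assoc, ← mul_pow, neg_mul]
  have hβ : ∀ k, ∃ β : ℕ → ℝ, k ≤ r → Tendsto (fun N : ℕ => √(N : ℝ) ^ r *
      ‖a k N - ∑ p ∈ Finset.range (r / 2 + 1), (β p : ℂ) / (N : ℂ) ^ p‖) atTop (𝓝 0) := by
    intro k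
    by_cases hk : k ≤ r
    · obtain ⟨β, h⟩ := (haexp k hk).exists_real (hareal k)
      exact ⟨β, fun _ => h⟩
    · exact ⟨0, fun h => absurd h hk⟩
  choose β hβ using hβ
  set R : ℕ → ℕ → ℂ := fun k N =>
    a k N - ∑ p ∈ Finset.range (r / 2 + 1), (β k p : ℂ) / (N : ℂ) ^ p with hR
  set Q : ℕ → Polynomial ℝ := fun p => ∑ k ∈ Finset.range (r + 1),
    Polynomial.C (β k p / k.factorial) * Polynomial.X ^ k with hQ
  set cond : ℕ → Prop := fun N => ∀ f ∈ functionSpace (q + 2) (r + 1), ∀ t : ℝ, δ ≤ |t| →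
      ‖fhat f t‖ * ‖φ N t‖ ≤ (mixedNorm (q + 2) (r + 1) f).toReal * b N * (1 + t ^ 2)⁻¹ with hcond
  -- The final bound is required for every `N ≥ 1`. Where `H3` may fail, `|φ_N| ≤ 1` and
  -- `norm_fhat_le` give the constant `2`; only finitely many `N` are affected.
  set b' : ℕ → ℝ := fun N => if cond N then b N else 2 with hb'
  have hb'lim : Tendsto (fun N : ℕ => √(N : ℝ) ^ r * (√(N : ℝ) * b' N)) atTop (𝓝 0) := by
    refine hb.congr' ?_
    filter_upwards [H3] with N hN
    have : cond N := hN
    simp only [hb', if_pos this]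
  have H3' : ∀ N, ∀ f ∈ functionSpace (q + 2) (r + 1), ∀ t : ℝ, δ ≤ |t| →
      ‖fhat f t‖ * ‖φ N t‖ ≤ (mixedNorm (q + 2) (r + 1) f).toReal * b' N * (1 + t ^ 2)⁻¹ := by
    intro N f hf t ht
    by_cases hN : cond N
    · simp only [hb', if_pos hN]
      exact hN f hf t ht
    · simp only [hb', if_neg hN]
      have h1 := norm_fhat_le hf (by omega) t
      have h2 := norm_centeredCharFun_le P (S := S) A N t
      calc _ ≤ ‖fhat f t‖ * 1 := by gcongr
        _ ≤ _ := by rw [mul_one]; linarith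
  set J : ℕ → ℝ := fun N => √(N : ℝ) * ∫ t in -δ..δ, |t| ^ (r + 1) * ‖φ N t‖ with hJ
  -- The constant `4` comes from the Taylor remainder of the transform, and the inner `π` is the
  -- integral of `(1 + t²)⁻¹`.
  set ε : ℕ → ℝ := fun N => (2 * Real.pi)⁻¹ *
    (4 * J N + ∑ k ∈ Finset.range (r + 1), ‖R k N‖ + Real.pi * (√(N : ℝ) * b' N)) with hε
  have hQf : ∀ (f : ℝ → ℂ) (p : ℕ) (z : ℝ), (((Q p).eval z : ℝ) : ℂ) * f z =
      ∑ k ∈ Finset.range (r + 1), ((β k p : ℂ) / (k.factorial : ℂ)) * ((z : ℂ) ^ k * f z) := by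
    intro f p z
    simp only [hQ, Polynomial.eval_finsetSum, Polynomial.eval_mul, Polynomial.eval_C,
      Polynomial.eval_pow, Polynomial.eval_X]
    push_cast
    rw [Finset.sum_mul]
    exact Finset.sum_congr rfl fun k _ => by ring
  have hmi : ∀ f ∈ functionSpace (q + 2) (r + 1), ∀ k ∈ Finset.range (r + 1), ∀ c : ℂ,
      Integrable fun z : ℝ => c * ((z : ℂ) ^ k * f z) := fun f hf k hk c =>
    (moment_bounds hf (Finset.mem_range.1 hk).le).1.const_mul c
  refine ⟨Q, ε, ?_, fun f hf => ⟨fun p _ => ?_, fun N hN => ⟨?_, ?_⟩⟩⟩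
  · have hlim : Tendsto (fun N : ℕ => √(N : ℝ) ^ r * ε N) atTop (𝓝 0) := by
      have h1 : Tendsto (fun N : ℕ => ∑ k ∈ Finset.range (r + 1), √(N : ℝ) ^ r * ‖R k N‖)
          atTop (𝓝 0) := by
        have := tendsto_finsetSum (Finset.range (r + 1)) fun k hk =>
          hβ k (Nat.lt_succ_iff.1 (Finset.mem_range.1 hk))
        simpa using this
      have h2 := (((H2.const_mul 4).add h1).add (hb'lim.const_mul Real.pi)).const_mul
        (2 * Real.pi)⁻¹
      simp only [mul_zero, add_zero] at h2
      refine h2.congr fun N => ?_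
      simp only [hε, hJ, ← Finset.mul_sum]
      ring
    refine (isLittleO_iff_tendsto' ?_).2 (hlim.congr' ?_)
    · filter_upwards [eventually_ge_atTop 1] with N hN h0
      exact absurd h0 (Real.rpow_pos_of_pos (by exact_mod_cast hN) _).ne'
    · filter_upwards [eventually_ge_atTop 1] with N hN
      have hN0 : (0 : ℝ) < N := by exact_mod_cast hN
      have : (N : ℝ) ^ (-(r : ℝ) / 2) = (√(N : ℝ) ^ r)⁻¹ := by
        rw [neg_div, Real.rpow_neg hN0.le, Real.sqrt_eq_rpow, ← Real.rpow_natCast,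
          ← Real.rpow_mul hN0.le]
        congr 2
        ring
      rw [this, div_inv_eq_mul, mul_comm]
  · simp_rw [hQf]
    exact integrable_finsetSum _ fun k hk => hmi f hf k hk _
  · have hfc := hf.1.continuous.measurable
    have := hS N
    refine Integrable.of_bound (Measurable.aestronglyMeasurable (by fun_prop))
      (mixedNorm (q + 2) (r + 1) f).toReal
      (Eventually.of_forall fun ω => norm_le_of_mem_functionSpace hf (by omega) _)
  · set C := (mixedNorm (q + 2) (r + 1) f).toReal with hC
    have hC0 : 0 ≤ C := ENNReal.toReal_nonneg
    set M : ℕ → ℂ := fun k => ∫ x : ℝ, (x : ℂ) ^ k * f x with hM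
    have hMle : ∀ k ∈ Finset.range (r + 1), ‖M k‖ ≤ C := fun k hk =>
      (norm_integral_le_integral_norm _).trans (moment_bounds hf (Finset.mem_range.1 hk).le).2
    have hfc : Continuous (fhat f) := continuous_fhat (integrable_of_mem_functionSpace hf)
    have hE : ∫ ω, f (S N ω - N * A) ∂P = (2 * (Real.pi : ℂ))⁻¹ * ∫ t : ℝ, fhat f t * φ N t :=
      integral_comp_eq_integral_fhat hf (by omega) ((hS N).sub_const _)
    have hint : Integrable fun t => fhat f t * φ N t :=
      (integrable_fhat hf (by omega)).mul_bdd (c := 1) (hφc N).aestronglyMeasurable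
        (Eventually.of_forall fun t => norm_centeredCharFun_le P A N t)
    set I₂ := ∫ t in (Set.Ioc (-δ) δ)ᶜ, fhat f t * φ N t with hI₂
    have hsplit : ∫ t : ℝ, fhat f t * φ N t = (∫ t in -δ..δ, fhat f t * φ N t) + I₂ := by
      rw [intervalIntegral.integral_of_le (by linarith), integral_add_compl measurableSet_Ioc hint]
    have hI₂le : ‖I₂‖ ≤ Real.pi * (C * b' N) := by
      -- No sign is assumed for `b`; the tail inequality at `t = δ` supplies it.
      have hCb : 0 ≤ C * b' N := by
        have h1 := H3' N f hf δ (le_abs_self δ)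
        have h2 : 0 ≤ ‖fhat f δ‖ * ‖φ N δ‖ := by positivity
        exact nonneg_of_mul_nonneg_left (h2.trans h1) (by positivity)
      calc ‖I₂‖ ≤ ∫ t in (Set.Ioc (-δ) δ)ᶜ, C * b' N * (1 + t ^ 2)⁻¹ := by
            refine norm_integral_le_of_norm_le (integrable_inv_one_add_sq.const_mul _).integrableOn ?_
            refine (ae_restrict_iff' measurableSet_Ioc.compl).2 (Eventually.of_forall fun t ht => ?_)
            rw [norm_mul]
            refine H3' N f hf t ?_
            by_contra! hlt
            rw [abs_lt] at hlt
            exact ht ⟨hlt.1, hlt.2.le⟩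
        _ ≤ ∫ t : ℝ, C * b' N * (1 + t ^ 2)⁻¹ :=
            setIntegral_le_integral (integrable_inv_one_add_sq.const_mul _)
              (Eventually.of_forall fun t => by positivity)
        _ = _ := by rw [integral_const_mul, integral_univ_inv_one_add_sq]; ring
    set T : ℝ → ℂ := fun t => ∑ k ∈ Finset.range (r + 1),
      (-(Complex.I * t)) ^ k / (k.factorial : ℂ) * M k with hT
    set I₁ := ∫ t in -δ..δ, (fhat f t - T t) * φ N t with hI₁
    have hφN := hφc N
    have hsplit₁ : ((√(N : ℝ) : ℝ) : ℂ) * ∫ t in -δ..δ, fhat f t * φ N t =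
        ((√(N : ℝ) : ℝ) : ℂ) * I₁ +
          ∑ k ∈ Finset.range (r + 1), M k / (k.factorial : ℂ) * a k N := by
      have h1 : ∫ t in -δ..δ, fhat f t * φ N t = I₁ + ∫ t in -δ..δ, T t * φ N t := by
        rw [hI₁, ← intervalIntegral.integral_add]
        · congr 1
          ext t
          ring
        · exact Continuous.intervalIntegrable (by fun_prop) _ _
        · exact Continuous.intervalIntegrable (by fun_prop) _ _
      have h2 : ∫ t in -δ..δ, T t * φ N t = ∑ k ∈ Finset.range (r + 1),
          M k / (k.factorial : ℂ) * ∫ t in -δ..δ, (-(Complex.I * t)) ^ k * φ N t := by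
        simp_rw [← intervalIntegral.integral_const_mul]
        rw [← intervalIntegral.integral_finsetSum]
        · congr 1
          ext t
          rw [hT]
          simp only
          rw [Finset.sum_mul]
          exact Finset.sum_congr rfl fun k _ => by ring
        · intro k _
          exact Continuous.intervalIntegrable (by fun_prop) _ _
      rw [h1, h2, mul_add, Finset.mul_sum]
      congr 1
      refine Finset.sum_congr rfl fun k _ => ?_
      rw [ha]
      ring
    have hI₁le : ‖I₁‖ ≤ 4 * C * ∫ t in -δ..δ, |t| ^ (r + 1) * ‖φ N t‖ := by
      rw [← intervalIntegral.integral_const_mul]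
      refine intervalIntegral.norm_integral_le_of_norm_le (by linarith)
        (Eventually.of_forall fun t _ => ?_) (Continuous.intervalIntegrable (by fun_prop) _ _)
      rw [norm_mul]
      calc ‖fhat f t - T t‖ * ‖φ N t‖ ≤ (4 * |t| ^ (r + 1) * C) * ‖φ N t‖ := by
            gcongr
            exact norm_fhat_sub_sum_le hf t
        _ = _ := by ring
    have hpoly : ∑ p ∈ Finset.range (r / 2 + 1),
        1 / (N : ℂ) ^ p * ∫ z : ℝ, (((Q p).eval z : ℝ) : ℂ) * f z =
        ∑ k ∈ Finset.range (r + 1), M k / (k.factorial : ℂ) *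
          ∑ p ∈ Finset.range (r / 2 + 1), (β k p : ℂ) / (N : ℂ) ^ p := by
      simp_rw [hQf, Finset.mul_sum]
      rw [Finset.sum_comm]
      refine Finset.sum_congr rfl fun p _ => ?_
      rw [integral_finsetSum _ fun k hk => hmi f hf k hk _, Finset.mul_sum]
      refine Finset.sum_congr rfl fun k _ => ?_
      rw [integral_const_mul]
      ring
    have hD : ((√(N : ℝ) : ℝ) : ℂ) * (∫ ω, f (S N ω - N * A) ∂P) -
        1 / (2 * (Real.pi : ℂ)) * ∑ p ∈ Finset.range (r / 2 + 1),
          1 / (N : ℂ) ^ p * ∫ z : ℝ, (((Q p).eval z : ℝ) : ℂ) * f z =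
        (2 * (Real.pi : ℂ))⁻¹ * (((√(N : ℝ) : ℝ) : ℂ) * I₁ +
          ∑ k ∈ Finset.range (r + 1), M k / (k.factorial : ℂ) * R k N +
          ((√(N : ℝ) : ℝ) : ℂ) * I₂) := by
      have h3 : ∑ k ∈ Finset.range (r + 1), M k / (k.factorial : ℂ) * R k N =
          (∑ k ∈ Finset.range (r + 1), M k / (k.factorial : ℂ) * a k N) -
          ∑ k ∈ Finset.range (r + 1), M k / (k.factorial : ℂ) *
          ∑ p ∈ Finset.range (r / 2 + 1), (β k p : ℂ) / (N : ℂ) ^ p := by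
        rw [← Finset.sum_sub_distrib]
        exact Finset.sum_congr rfl fun k _ => by rw [hR]; ring
      rw [hE, hsplit, hpoly, h3, mul_left_comm, mul_add ((√(N : ℝ) : ℝ) : ℂ), hsplit₁]
      ring
    rw [hD, norm_mul, norm_inv, norm_mul, Complex.norm_real, Real.norm_of_nonneg Real.pi_pos.le,
      Complex.norm_ofNat]
    have hw : ‖((√(N : ℝ) : ℝ) : ℂ)‖ = √(N : ℝ) := by
      rw [Complex.norm_real, Real.norm_of_nonneg (Real.sqrt_nonneg _)]
    have hsum : ‖∑ k ∈ Finset.range (r + 1), M k / (k.factorial : ℂ) * R k N‖ ≤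
        C * ∑ k ∈ Finset.range (r + 1), ‖R k N‖ := by
      rw [Finset.mul_sum]
      refine (norm_sum_le _ _).trans (Finset.sum_le_sum fun k hk => ?_)
      rw [norm_mul, norm_div, Complex.norm_natCast]
      gcongr
      exact (div_le_self (norm_nonneg _) (by exact_mod_cast k.factorial_pos)).trans (hMle k hk)
    calc (2 * Real.pi)⁻¹ * ‖((√(N : ℝ) : ℝ) : ℂ) * I₁ +
          ∑ k ∈ Finset.range (r + 1), M k / (k.factorial : ℂ) * R k N +
          ((√(N : ℝ) : ℝ) : ℂ) * I₂‖
        ≤ (2 * Real.pi)⁻¹ * (√(N : ℝ) * (4 * C * ∫ t in -δ..δ, |t| ^ (r + 1) * ‖φ N t‖) +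
          C * ∑ k ∈ Finset.range (r + 1), ‖R k N‖ + √(N : ℝ) * (Real.pi * (C * b' N))) := by
          gcongr
          refine (norm_add₃_le).trans ?_
          rw [norm_mul, norm_mul, hw]
          gcongr
      _ = C * ε N := by
          simp only [hε, hJ]
          ring

end Assembly

/-! ### Taylor coefficients of the phase and the normal limit. -/

section LocalForm

theorem exists_taylor_isLittleO {n : ℕ} {χ : ℝ → ℂ} (h : ContDiffAt ℝ n χ 0) :
    ∃ a : ℕ → ℂ, a 0 = χ 0 ∧
      (fun t : ℝ => χ t - ∑ k ∈ Finset.range (n + 1), a k * (t : ℂ) ^ k) =o[𝓝 0]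
        fun t => t ^ n := by
  obtain ⟨u, hu, hχ⟩ := h.contDiffOn le_rfl (by simp)
  have hu' : u ∈ 𝓝 (0 : ℝ) := by simpa using hu
  obtain ⟨ε, hε, hball⟩ := Metric.mem_nhds_iff.1 hu'
  have hs : Metric.ball (0 : ℝ) ε ∈ 𝓝 0 := Metric.ball_mem_nhds _ hε
  have ht := taylor_isLittleO (convex_ball (0 : ℝ) ε) (Metric.mem_ball_self hε) (hχ.mono hball)
  rw [nhdsWithin_eq_nhds.2 hs] at ht
  refine ⟨fun k => ((k.factorial : ℝ)⁻¹ : ℝ) • iteratedDerivWithin k χ (Metric.ball 0 ε) 0,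
    by simp, ?_⟩
  refine ht.congr (fun t => ?_) fun t => by rw [sub_zero]
  rw [taylor_within_apply]
  congr 1
  refine Finset.sum_congr rfl fun k _ => ?_
  simp only [Complex.real_smul, sub_zero]
  push_cast
  ring

/-- Separation of the constant, linear and quadratic Taylor coefficients. -/
theorem exists_cubic_isLittleO {r : ℕ} {χ : ℝ → ℂ} (h : ContDiffAt ℝ (r + 2 : ℕ) χ 0)
    (h0 : χ 0 = 0) :
    ∃ (a₁ a₂ : ℂ) (p : Polynomial ℂ),
      (fun t : ℝ => χ t - a₁ * t - a₂ * (t : ℂ) ^ 2 - (t : ℂ) ^ 3 * p.eval (t : ℂ)) =o[𝓝 0]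
        fun t => t ^ (r + 2) := by
  obtain ⟨a, ha0, ha⟩ := exists_taylor_isLittleO h
  refine ⟨a 1, a 2, ∑ k ∈ Finset.range r, Polynomial.C (a (k + 3)) * Polynomial.X ^ k,
    ha.congr_left fun t => ?_⟩
  rw [Finset.sum_range_succ', Finset.sum_range_succ', Finset.sum_range_succ']
  simp only [Polynomial.eval_finsetSum, Polynomial.eval_mul, Polynomial.eval_C,
    Polynomial.eval_pow, Polynomial.eval_X, Finset.mul_sum]
  rw [ha0, h0]
  have : ∀ k, a (k + 1 + 1 + 1) * (t : ℂ) ^ (k + 1 + 1 + 1) =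
      (t : ℂ) ^ 3 * (a (k + 3) * (t : ℂ) ^ k) := fun k => by ring
  simp only [this]
  ring

theorem tendsto_div_sqrt (s : ℝ) : Tendsto (fun N : ℕ => s / √(N : ℝ)) atTop (𝓝 0) :=
  tendsto_sqrt_natCast.const_div_atTop s

theorem tendsto_natCast_mul_of_isLittleO {χ : ℝ → ℂ} {a : ℂ}
    (h : (fun t : ℝ => χ t - a * (t : ℂ) ^ 2) =o[𝓝 0] fun t => t ^ 2) (s : ℝ) :
    Tendsto (fun N : ℕ => (N : ℂ) * χ (s / √(N : ℝ))) atTop (𝓝 (a * (s : ℂ) ^ 2)) := by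
  have h1 := h.comp_tendsto (tendsto_div_sqrt s)
  have h2 : (fun N : ℕ => (N : ℂ) * (χ (s / √(N : ℝ)) - a * ((s / √(N : ℝ) : ℝ) : ℂ) ^ 2))
      =o[atTop] fun N : ℕ => (N : ℝ) * (s / √(N : ℝ)) ^ 2 :=
    (IsBigO.of_norm_le (fun N => by simp) : (fun N : ℕ => (N : ℂ)) =O[atTop]
      fun N : ℕ => (N : ℝ)).mul_isLittleO h1
  have hN : ∀ᶠ N : ℕ in atTop, (N : ℝ) * (s / √(N : ℝ)) ^ 2 = s ^ 2 := by
    filter_upwards [eventually_gt_atTop 0] with N hN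
    have : (N : ℝ) ≠ 0 := by positivity
    rw [div_pow, Real.sq_sqrt (Nat.cast_nonneg N)]
    field_simp
  have h3 := (h2.congr' EventuallyEq.rfl hN)
  have h4 : Tendsto (fun N : ℕ => (N : ℂ) * (χ (s / √(N : ℝ)) -
      a * ((s / √(N : ℝ) : ℝ) : ℂ) ^ 2)) atTop (𝓝 0) := by
    rw [← isLittleO_one_iff ℝ]
    exact h3.trans_isBigO (isBigO_const_const _ one_ne_zero _)
  have h5 := h4.add_const (a * (s : ℂ) ^ 2)
  rw [zero_add] at h5
  refine h5.congr' ?_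
  filter_upwards [hN] with N hN
  have : (N : ℂ) * ((s / √(N : ℝ) : ℝ) : ℂ) ^ 2 = (s : ℂ) ^ 2 := by exact_mod_cast hN
  linear_combination -a * this

theorem norm_le_one_of_pow_bounded {z w : ℂ} {D : ℝ} (hw : w ≠ 0)
    (h : ∀ N : ℕ, 1 ≤ N → ‖z ^ N * w‖ ≤ D) : ‖z‖ ≤ 1 := by
  by_contra! hz
  have ht := (tendsto_pow_atTop_atTop_of_one_lt hz).atTop_mul_const (norm_pos_iff.2 hw)
  obtain ⟨N, hN, hN1⟩ := ((ht.eventually_gt_atTop D).and (eventually_ge_atTop 1)).exists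
  have := h N hN1
  rw [norm_mul, norm_pow] at this
  linarith

/-- The real part of `χ` is nonpositive on both sides of `0`, so its slope there has neither sign.
-/
theorem re_eq_zero_of_isLittleO {χ : ℝ → ℂ} {a : ℂ}
    (h : (fun t : ℝ => χ t - a * t) =o[𝓝 0] fun t => t) (hre : ∀ᶠ t in 𝓝 0, (χ t).re ≤ 0) :
    a.re = 0 := by
  have key : ∀ σ : ℝ, |σ| = 1 → σ * a.re ≤ 0 := by
    intro σ hσ
    refine le_of_forall_pos_le_add fun ε hε => ?_
    obtain ⟨t, ht, ht0⟩ : ∃ t : ℝ, (‖χ (σ * t) - a * ((σ * t : ℝ) : ℂ)‖ ≤ ε * ‖σ * t‖ ∧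
        (χ (σ * t)).re ≤ 0) ∧ 0 < t := by
      have hlim : Tendsto (fun t : ℝ => σ * t) (𝓝[>] 0) (𝓝 0) := by
        have : Continuous fun t : ℝ => σ * t := by fun_prop
        simpa using (this.tendsto 0).mono_left nhdsWithin_le_nhds
      exact ((hlim.eventually ((h.bound hε).and hre)).and self_mem_nhdsWithin).exists
    have h1 := (Complex.abs_re_le_norm _).trans ht.1
    rw [Real.norm_eq_abs, abs_mul, hσ, one_mul, abs_of_pos ht0, Complex.sub_re,
      Complex.re_mul_ofReal] at h1
    have h2 := (abs_le.1 h1).1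
    have h3 : (σ * a.re) * t ≤ (0 + ε) * t := by nlinarith [ht.2]
    exact le_of_mul_le_mul_right h3 ht0
  have h1 := key 1 (by simp)
  have h2 := key (-1) (by simp)
  linarith

variable {Ω : Type*} [MeasurableSpace Ω] (P : Measure Ω) [IsProbabilityMeasure P]
  {S : ℕ → Ω → ℝ}

omit [IsProbabilityMeasure P] in
theorem centeredCharFun_eq (A : ℝ) (N : ℕ) (t : ℝ) :
    centeredCharFun P S A N t = Complex.exp (-(N * (Complex.I * A * t))) *
      ∫ ω, Complex.exp (Complex.I * t * S N ω) ∂P := by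
  rw [centeredCharFun, ← integral_const_mul]
  congr 1
  ext ω
  rw [← Complex.exp_add]
  congr 1
  push_cast
  ring

/-- If the characteristic functions of the rescaled sums converge to `exp (a s ^ 2)`, then `a` is a
nonpositive real number. -/
theorem nonpos_real_of_tendsto_charFun {A : ℝ} {a : ℂ}
    (h : ∀ s : ℝ, Tendsto (fun N : ℕ => centeredCharFun P S A N (s / √(N : ℝ))) atTop
      (𝓝 (Complex.exp (a * (s : ℂ) ^ 2)))) : a.im = 0 ∧ a.re ≤ 0 := by
  constructor
  · have hconj : ∀ s : ℝ, (starRingEnd ℂ) (Complex.exp (a * (s : ℂ) ^ 2)) =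
        Complex.exp (a * (s : ℂ) ^ 2) := by
      intro s
      have h1 := (Complex.continuous_conj.tendsto _).comp (h s)
      have h2 := h (-s)
      rw [Complex.ofReal_neg, neg_sq] at h2
      refine tendsto_nhds_unique (h1.congr fun N => ?_) h2
      simp only [Function.comp_apply]
      rw [conj_centeredCharFun, neg_div]
    by_contra him
    -- This scale makes `|a.im| s² < 1 < π`, so a vanishing sine forces `a.im = 0`.
    set s := √(|a.im| + 1)⁻¹ with hs
    have hs2 : s ^ 2 = (|a.im| + 1)⁻¹ := Real.sq_sqrt (by positivity)
    have h1 := Complex.conj_eq_iff_im.1 (hconj s)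
    rw [Complex.exp_im, mul_eq_zero] at h1
    have h2 := h1.resolve_left (Real.exp_pos _).ne'
    rw [← Complex.ofReal_pow, Complex.im_mul_ofReal, hs2] at h2
    have hab : |a.im * (|a.im| + 1)⁻¹| < Real.pi := by
      rw [abs_mul, abs_inv, abs_of_pos (by positivity : 0 < |a.im| + 1), ← div_eq_mul_inv,
        div_lt_iff₀ (by positivity)]
      nlinarith [Real.pi_gt_three, abs_nonneg a.im]
    rw [abs_lt] at hab
    rw [Real.sin_eq_zero_iff_of_lt_of_lt hab.1 hab.2, mul_eq_zero] at h2
    exact him (h2.resolve_right (by positivity))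
  · have h1 : ‖Complex.exp (a * ((1 : ℝ) : ℂ) ^ 2)‖ ≤ 1 :=
      le_of_tendsto (h 1).norm (Eventually.of_forall fun N => norm_centeredCharFun_le P A N _)
    rw [Complex.norm_exp, Real.exp_le_one_iff] at h1
    simpa using h1

/-- Lévy's continuity theorem; the variance is `2 c` because the Gaussian characteristic function is
`exp(-σ² s² / 2)`. -/
theorem normalLimit_of_tendsto_charFun (hS : ∀ N, Measurable (S N)) {A c : ℝ} (hc : 0 ≤ c)
    (h : ∀ s : ℝ, Tendsto (fun N : ℕ => centeredCharFun P S A N (s / √(N : ℝ))) atTop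
      (𝓝 (Complex.exp (-c * (s : ℂ) ^ 2)))) :
    NormalLimit P S A (2 * c).toNNReal := by
  have hm : ∀ N : ℕ, Measurable fun ω => (S N ω - N * A) / √(N : ℝ) := fun N =>
    ((hS N).sub_const _).div_const _
  refine ⟨fun N => (hm N).aemeasurable, by fun_prop, ?_⟩
  refine ProbabilityMeasure.tendsto_iff_tendsto_charFun.2 fun s => ?_
  have hlim : charFun ((gaussianReal 0 (2 * c).toNNReal).map fun x : ℝ => x) s =
      Complex.exp (-c * (s : ℂ) ^ 2) := by
    rw [Measure.map_id', charFun_gaussianReal, Real.coe_toNNReal _ (by positivity)]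
    congr 1
    push_cast
    ring
  simp only [ProbabilityMeasure.coe_mk]
  rw [hlim]
  refine (h s).congr fun N => ?_
  rw [charFun_apply, integral_map (hm N).aemeasurable
    (Continuous.aestronglyMeasurable (by fun_prop)), centeredCharFun]
  congr 1
  ext ω
  congr 1
  simp only [RCLike.inner_apply, conj_trivial]
  push_cast
  ring

end LocalForm

/-! ### The characteristic function near frequency zero. -/

section Main

variable {Ω : Type*} [MeasurableSpace Ω] (P : Measure Ω) [IsProbabilityMeasure P]
  {S : ℕ → Ω → ℝ} {B : Type*} [NormedAddCommGroup B] [NormedSpace ℂ B] [CompleteSpace B]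

/-- Near frequency zero the characteristic function of the centred sum is
`Z(t) exp (N (-c t² + ψ(t)))` up to an exponentially small error. -/
theorem exists_local_form {L : ℝ → B →L[ℂ] B} {v : B} {l : B →L[ℂ] ℂ} {r : ℕ}
    (hchar : ∀ (N : ℕ) (t : ℝ), 1 ≤ N →
      ∫ ω, Complex.exp (Complex.I * t * S N ω) ∂P = l ((L t ^ N) v))
    (hL : ContDiffAt ℝ (r + 2 : ℕ) L 0) (hA2 : AssumptionA2 (L 0)) :
    ∃ (A c C κ : ℝ) (ψ Z : ℝ → ℂ) (p : Polynomial ℂ), 0 ≤ c ∧ 0 < κ ∧ κ < 1 ∧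
      ((fun t => ψ t - (t : ℂ) ^ 3 * p.eval (t : ℂ)) =o[𝓝 0] fun t => t ^ (r + 2)) ∧
      (∀ᶠ t in 𝓝 0, ContinuousAt ψ t) ∧ ContDiffAt ℝ (r + 2 : ℕ) Z 0 ∧
      (∀ᶠ t in 𝓝 0, ∀ N : ℕ, 1 ≤ N →
        ‖centeredCharFun P S A N t - Z t * Complex.exp (N * (-c * (t : ℂ) ^ 2 + ψ t))‖ ≤
          C * κ ^ N) ∧
      ∀ s : ℝ, Tendsto (fun N : ℕ => centeredCharFun P S A N (s / √(N : ℝ))) atTop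
        (𝓝 (Complex.exp (-c * (s : ℂ) ^ 2))) := by
  obtain ⟨lam, Z, C, κ, hlam, hZ, hlam0, hκ0, hκ1, hev⟩ :=
    exists_leading_eigenvalue (by omega) hL hA2 v l
  have hκt : Tendsto (fun N : ℕ => C * κ ^ N) atTop (𝓝 0) := by
    simpa using (tendsto_pow_atTop_nhds_zero_of_lt_one hκ0.le hκ1).const_mul C
  -- At `t = 0` the characteristic function equals `1`, so `|1 - Z 0|` lies below an exponentially
  -- small bound for every `N`.
  have hZ0 : Z 0 = 1 := by
    have h1 : ∀ N : ℕ, 1 ≤ N → ‖1 - Z 0‖ ≤ C * κ ^ N := by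
      intro N hN
      have h2 := hev.self_of_nhds N hN
      rw [← hchar N 0 hN, hlam0] at h2
      simpa using h2
    have h3 : ‖1 - Z 0‖ ≤ 0 :=
      ge_of_tendsto hκt ((eventually_ge_atTop 1).mono fun N hN => h1 N hN)
    rw [norm_le_zero_iff, sub_eq_zero] at h3
    exact h3.symm
  have hZne : ∀ᶠ t in 𝓝 (0 : ℝ), Z t ≠ 0 :=
    hZ.continuousAt.eventually_ne (by rw [hZ0]; exact one_ne_zero)
  -- Characteristic functions are bounded by `1`, so `lam t ^ N * Z t` stays bounded in `N`, which
  -- with `Z t ≠ 0` excludes `|lam t| > 1`.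
  have hlamle : ∀ᶠ t in 𝓝 (0 : ℝ), ‖lam t‖ ≤ 1 := by
    filter_upwards [hev, hZne] with t ht htZ
    refine norm_le_one_of_pow_bounded (D := 1 + |C|) htZ fun N hN => ?_
    have h1 := ht N hN
    rw [← hchar N t hN] at h1
    have h2 : ‖∫ ω, Complex.exp (Complex.I * t * S N ω) ∂P‖ ≤ 1 := by
      refine (norm_integral_le_integral_norm _).trans ?_
      simp only [norm_exp_I_mul_mul]
      simp
    have h3 : C * κ ^ N ≤ |C| * 1 :=
      mul_le_mul (le_abs_self C) (pow_le_one₀ hκ0.le hκ1.le) (by positivity) (abs_nonneg C)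
    have h4 := norm_sub_norm_le (lam t ^ N * Z t) (∫ ω, Complex.exp (Complex.I * t * S N ω) ∂P)
    rw [norm_sub_rev] at h4
    linarith
  set χ : ℝ → ℂ := fun t => Complex.log (lam t) with hχ
  have hslit : lam 0 ∈ Complex.slitPlane := by rw [hlam0]; exact Complex.one_mem_slitPlane
  have hχc : ContDiffAt ℝ (r + 2 : ℕ) χ 0 :=
    ((Complex.contDiffAt_log hslit).restrict_scalars ℝ).comp 0 hlam
  have hχ0 : χ 0 = 0 := by simp [hχ, hlam0]
  have hexp : ∀ᶠ t in 𝓝 (0 : ℝ), Complex.exp (χ t) = lam t := by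
    filter_upwards [hlam.continuousAt.eventually_ne (by rw [hlam0]; exact one_ne_zero)] with t ht
    exact Complex.exp_log ht
  have hχre : ∀ᶠ t in 𝓝 (0 : ℝ), (χ t).re ≤ 0 := by
    filter_upwards [hlamle] with t ht
    rw [hχ, Complex.log_re]
    exact Real.log_nonpos (norm_nonneg _) ht
  obtain ⟨a₁, a₂, p, hp⟩ := exists_cubic_isLittleO hχc hχ0
  have hcubic := isBigO_pow_mul_eval 3 p
  have hquad : (fun t : ℝ => χ t - a₁ * t - a₂ * (t : ℂ) ^ 2) =o[𝓝 0] fun t => t ^ 2 := by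
    have h1 := hp.trans_isBigO (isBigO_pow_of_le (Nat.le_add_left 2 r))
    simpa using h1.add (hcubic.trans_isLittleO (isLittleO_pow_of_lt (by norm_num : 2 < 3)))
  have hlin : (fun t : ℝ => χ t - a₁ * t) =o[𝓝 0] fun t => t := by
    have h1 := isBigO_pow_mul_eval 2 (Polynomial.C a₂)
    have h2 : (fun t : ℝ => t ^ 2) =o[𝓝 0] fun t => t := by
      simpa using isLittleO_pow_of_lt (by norm_num : 1 < 2)
    refine ((hquad.trans h2).add (h1.trans_isLittleO h2)).congr_left fun t => ?_
    rw [Polynomial.eval_C]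
    ring
  have ha₁ : a₁.re = 0 := re_eq_zero_of_isLittleO hlin hχre
  -- As `Re χ ≤ 0`, the linear coefficient is purely imaginary; its imaginary part is the drift
  -- removed by centring.
  set A := a₁.im with hA
  have ha₁' : a₁ = Complex.I * A := by
    apply Complex.ext <;> simp [ha₁, hA]
  have hform : ∀ᶠ t in 𝓝 (0 : ℝ), ∀ N : ℕ, 1 ≤ N →
      ‖centeredCharFun P S A N t - Z t * Complex.exp (N * (χ t - a₁ * t))‖ ≤ C * κ ^ N := by
    filter_upwards [hev, hexp] with t ht hte N hN
    have h1 : centeredCharFun P S A N t - Z t * Complex.exp (N * (χ t - a₁ * t)) =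
        Complex.exp (-(N * (Complex.I * A * t))) * (l ((L t ^ N) v) - lam t ^ N * Z t) := by
      rw [centeredCharFun_eq, hchar N t hN, ha₁', mul_sub, sub_eq_add_neg (N * χ t), Complex.exp_add,
        Complex.exp_nat_mul, hte]
      ring
    have h2 : ‖Complex.exp (-(N * (Complex.I * A * t)))‖ = 1 := by
      rw [show -((N : ℂ) * (Complex.I * A * t)) = ((-(N * A * t) : ℝ) : ℂ) * Complex.I by
        push_cast; ring, Complex.norm_exp_ofReal_mul_I]
    rw [h1, norm_mul, h2, one_mul]
    exact ht N hN
  have hlim : ∀ s : ℝ, Tendsto (fun N : ℕ => centeredCharFun P S A N (s / √(N : ℝ))) atTop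
      (𝓝 (Complex.exp (a₂ * (s : ℂ) ^ 2))) := by
    intro s
    have h1 : Tendsto (fun N : ℕ => Z (s / √(N : ℝ)) * Complex.exp
        (N * (χ (s / √(N : ℝ)) - a₁ * ((s / √(N : ℝ) : ℝ) : ℂ)))) atTop
        (𝓝 (1 * Complex.exp (a₂ * (s : ℂ) ^ 2))) := by
      have hZt := hZ.continuousAt.tendsto.comp (tendsto_div_sqrt s)
      rw [hZ0] at hZt
      exact hZt.mul ((Complex.continuous_exp.tendsto _).comp
        (tendsto_natCast_mul_of_isLittleO (χ := fun t => χ t - a₁ * t) hquad s))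
    rw [one_mul] at h1
    have h2 : Tendsto (fun N : ℕ => centeredCharFun P S A N (s / √(N : ℝ)) -
        Z (s / √(N : ℝ)) * Complex.exp
        (N * (χ (s / √(N : ℝ)) - a₁ * ((s / √(N : ℝ) : ℝ) : ℂ)))) atTop (𝓝 0) := by
      refine squeeze_zero_norm' ?_ hκt
      filter_upwards [(tendsto_div_sqrt s).eventually hform, eventually_ge_atTop 1] with N h hN
      exact h N hN
    simpa using h2.add h1
  obtain ⟨him, hre⟩ := nonpos_real_of_tendsto_charFun P hlim
  have ha₂ : a₂ = -((-a₂.re : ℝ) : ℂ) := by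
    apply Complex.ext <;> simp [him]
  refine ⟨A, -a₂.re, C, κ, fun t => χ t - a₁ * t - a₂ * (t : ℂ) ^ 2, Z, p, by linarith, hκ0, hκ1,
    hp, ?_, hZ, ?_, ?_⟩
  · have h1 : ∀ᶠ t in 𝓝 (0 : ℝ), ContinuousAt χ t :=
      ((hχc.of_le (m := 0) (by simp)).eventually (by simp)).mono fun t ht => ht.continuousAt
    filter_upwards [h1] with t ht
    have h2 : Continuous fun t : ℝ => a₁ * (t : ℂ) := by fun_prop
    have h3 : Continuous fun t : ℝ => a₂ * (t : ℂ) ^ 2 := by fun_prop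
    exact (ht.sub h2.continuousAt).sub h3.continuousAt
  · filter_upwards [hform] with t ht N hN
    have := ht N hN
    rw [← ha₂]
    rwa [show a₂ * (t : ℂ) ^ 2 + (χ t - a₁ * t - a₂ * (t : ℂ) ^ 2) = χ t - a₁ * t by ring]
  · rw [← ha₂]
    exact hlim

end Main

theorem sqrt_natCast_le (N : ℕ) : √(N : ℝ) ≤ N :=
  Real.sqrt_le_iff.2 ⟨Nat.cast_nonneg N, by exact_mod_cast Nat.le_self_pow two_ne_zero N⟩

/-! ### Remainder integrals and high frequencies. -/

section Conclusion

theorem tendsto_sqrt_pow_mul_pow {κ : ℝ} (hκ0 : 0 < κ) (hκ1 : κ < 1) (j : ℕ) :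
    Tendsto (fun N : ℕ => √(N : ℝ) ^ j * κ ^ N) atTop (𝓝 0) := by
  refine squeeze_zero (fun N => by positivity) (fun N => ?_)
    (tendsto_pow_const_mul_const_pow_of_lt_one j hκ0.le hκ1)
  gcongr
  exact sqrt_natCast_le N

variable {Ω : Type*} [MeasurableSpace Ω] (P : Measure Ω) [IsProbabilityMeasure P]
  {S : ℕ → Ω → ℝ}

/-- After `s = √N t`, the weight `|t|^(r+1)` yields one factor `N^(-1/2)` more than `√N^r · √N dt`
costs. -/
theorem tendsto_remainder_integral {φ : ℕ → ℝ → ℂ} (hφ : ∀ N, Continuous (φ N)) {c C M κ δ : ℝ}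
    (hc : 0 < c) (hκ0 : 0 < κ) (hκ1 : κ < 1) (hδ : 0 < δ) (r : ℕ)
    (h : ∀ t : ℝ, |t| ≤ δ → ∀ N : ℕ, 1 ≤ N →
      ‖φ N t‖ ≤ M * Real.exp (-c * (√(N : ℝ) * t) ^ 2) + C * κ ^ N) :
    Tendsto (fun N : ℕ => √(N : ℝ) ^ r * (√(N : ℝ) *
      ∫ t in -δ..δ, |t| ^ (r + 1) * ‖φ N t‖)) atTop (𝓝 0) := by
  set g : ℝ → ℝ := fun s => Real.exp (-c * s ^ 2) * |s| ^ (r + 1) with hg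
  have hgi : Integrable g := integrable_exp_neg_mul_sq_mul_abs_pow hc _
  set K := ∫ t in -δ..δ, |t| ^ (r + 1) with hK
  have hlim : Tendsto (fun N : ℕ => |M| * (∫ s, g s) * (√(N : ℝ))⁻¹ +
      C * K * (√(N : ℝ) ^ (r + 1) * κ ^ N)) atTop (𝓝 0) := by
    have h1 := ((tendsto_inv_atTop_zero.comp tendsto_sqrt_natCast).const_mul
      (|M| * ∫ s, g s)).add ((tendsto_sqrt_pow_mul_pow hκ0 hκ1 (r + 1)).const_mul (C * K))
    simpa using h1
  refine squeeze_zero' (Eventually.of_forall fun N => ?_) ?_ hlim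
  · have : 0 ≤ ∫ t in -δ..δ, |t| ^ (r + 1) * ‖φ N t‖ :=
      intervalIntegral.integral_nonneg (by linarith) fun t _ => by positivity
    positivity
  · filter_upwards [eventually_ge_atTop 1] with N hN
    have hw : 0 < √(N : ℝ) := Real.sqrt_pos.2 (by exact_mod_cast hN)
    have hφN := hφ N
    have h1 : ∫ t in -δ..δ, |t| ^ (r + 1) * ‖φ N t‖ ≤ ∫ t in -δ..δ,
        (|M| * (√(N : ℝ) ^ (r + 1))⁻¹ * g (√(N : ℝ) * t) + C * κ ^ N * |t| ^ (r + 1)) := by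
      refine intervalIntegral.integral_mono_on (by linarith)
        (Continuous.intervalIntegrable (by fun_prop) _ _)
        (Continuous.intervalIntegrable (by fun_prop) _ _) fun t ht => ?_
      have h2 : |t| ^ (r + 1) * ‖φ N t‖ ≤
          |t| ^ (r + 1) * (|M| * Real.exp (-c * (√(N : ℝ) * t) ^ 2) + C * κ ^ N) := by
        gcongr
        refine (h t (abs_le.2 ht) N hN).trans ?_
        gcongr
        exact le_abs_self M
      refine h2.trans (le_of_eq ?_)
      simp only [hg, abs_mul, abs_of_pos hw, mul_pow]
      field_simp
    have h3 : √(N : ℝ) * ∫ t in -δ..δ, g (√(N : ℝ) * t) ≤ ∫ s, g s := by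
      have h4 := intervalIntegral.smul_integral_comp_mul_left (a := -δ) (b := δ) g (√(N : ℝ))
      rw [smul_eq_mul] at h4
      have : √(N : ℝ) * -δ ≤ √(N : ℝ) * δ := by gcongr; linarith
      rw [h4, intervalIntegral.integral_of_le this]
      exact setIntegral_le_integral hgi (Eventually.of_forall fun s => by positivity)
    rw [intervalIntegral.integral_add (Continuous.intervalIntegrable (by fun_prop) _ _)
      (Continuous.intervalIntegrable (by fun_prop) _ _), intervalIntegral.integral_const_mul,
      intervalIntegral.integral_const_mul] at h1
    calc √(N : ℝ) ^ r * (√(N : ℝ) * ∫ t in -δ..δ, |t| ^ (r + 1) * ‖φ N t‖)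
        ≤ √(N : ℝ) ^ r * (√(N : ℝ) * (|M| * (√(N : ℝ) ^ (r + 1))⁻¹ *
          (∫ t in -δ..δ, g (√(N : ℝ) * t)) + C * κ ^ N * K)) := by gcongr
      _ = |M| * (√(N : ℝ) * ∫ t in -δ..δ, g (√(N : ℝ) * t)) * (√(N : ℝ))⁻¹ +
          C * K * (√(N : ℝ) ^ (r + 1) * κ ^ N) := by
        field_simp
        ring
      _ ≤ _ := by gcongr

theorem HasExpansion.integral_of_close {φ : ℕ → ℝ → ℂ} (hφ : ∀ N, Continuous (φ N))
    {Φ : ℕ → ℝ → ℂ} {C κ δ : ℝ} (hκ0 : 0 < κ) (hκ1 : κ < 1) (hδ : 0 < δ) {r k : ℕ}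
    (hΦc : ∀ N, ContinuousOn (Φ N) (Set.Icc (-δ) δ))
    (h : ∀ t : ℝ, |t| ≤ δ → ∀ N : ℕ, 1 ≤ N → ‖φ N t - Φ N t‖ ≤ C * κ ^ N)
    (hΦ : HasExpansion r fun N => ((√(N : ℝ) : ℝ) : ℂ) * ∫ t in -δ..δ, (t : ℂ) ^ k * Φ N t) :
    HasExpansion r fun N => ((√(N : ℝ) : ℝ) : ℂ) * ∫ t in -δ..δ, (t : ℂ) ^ k * φ N t := by
  refine hΦ.congr_of_tendsto ?_
  have hlim : Tendsto (fun N : ℕ => δ ^ k * C * |δ - -δ| * (√(N : ℝ) ^ (r + 1) * κ ^ N))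
      atTop (𝓝 0) := by
    simpa using (tendsto_sqrt_pow_mul_pow hκ0 hκ1 (r + 1)).const_mul (δ ^ k * C * |δ - -δ|)
  refine squeeze_zero_norm' ?_ hlim
  filter_upwards [eventually_ge_atTop 1] with N hN
  have hφN := hφ N
  have hi1 : IntervalIntegrable (fun t : ℝ => (t : ℂ) ^ k * φ N t) volume (-δ) δ :=
    Continuous.intervalIntegrable (by fun_prop) _ _
  have hi2 : IntervalIntegrable (fun t : ℝ => (t : ℂ) ^ k * Φ N t) volume (-δ) δ := by
    refine ContinuousOn.intervalIntegrable ?_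
    rw [Set.uIcc_of_le (by linarith)]
    exact ContinuousOn.mul (by fun_prop) (hΦc N)
  rw [← mul_sub, ← intervalIntegral.integral_sub hi1 hi2, norm_mul, norm_mul, norm_pow,
    Complex.norm_real, Real.norm_of_nonneg (Real.sqrt_nonneg _)]
  have h1 : ‖∫ t in -δ..δ, ((t : ℂ) ^ k * φ N t - (t : ℂ) ^ k * Φ N t)‖ ≤
      (δ ^ k * (C * κ ^ N)) * |δ - -δ| := by
    refine intervalIntegral.norm_integral_le_of_norm_le_const fun t ht => ?_
    rw [Set.uIoc_of_le (by linarith)] at ht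
    have ht' : |t| ≤ δ := abs_le.2 ⟨ht.1.le, ht.2⟩
    rw [← mul_sub, norm_mul, norm_pow, Complex.norm_real, Real.norm_eq_abs]
    gcongr
    exact h t ht' N hN
  calc _ ≤ √(N : ℝ) ^ r * (√(N : ℝ) * ((δ ^ k * (C * κ ^ N)) * |δ - -δ|)) := by gcongr
    _ = _ := by ring

variable {B : Type*} [NormedAddCommGroup B] [NormedSpace ℂ B] [CompleteSpace B]

/-- Away from frequency zero the contribution of the characteristic function is negligible. -/
theorem exists_high_frequency_bound {L : ℝ → B →L[ℂ] B} {v : B} {l : B →L[ℂ] ℂ} {r q : ℕ} {r₁ : ℝ}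
    (hchar : ∀ (N : ℕ) (t : ℝ), 1 ≤ N →
      ∫ ω, Complex.exp (Complex.I * t * S N ω) ∂P = l ((L t ^ N) v))
    (hL : Continuous L) (hA3 : AssumptionA3 L) (hA4 : AssumptionA4 L r₁)
    (hq : ((r : ℝ) + 1) / (2 * r₁) < q) (A : ℝ) {δ : ℝ} (hδ : 0 < δ) :
    ∃ b : ℕ → ℝ, Tendsto (fun N : ℕ => √(N : ℝ) ^ r * (√(N : ℝ) * b N)) atTop (𝓝 0) ∧
      ∀ᶠ N in atTop, ∀ f ∈ functionSpace (q + 2) (r + 1), ∀ t : ℝ, δ ≤ |t| →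
        ‖fhat f t‖ * ‖centeredCharFun P S A N t‖ ≤
          (mixedNorm (q + 2) (r + 1) f).toReal * b N * (1 + t ^ 2)⁻¹ := by
  have hr₁ : 0 < r₁ := hA4.1
  have hq0 : (0 : ℝ) < q := lt_of_le_of_lt (by positivity) hq
  -- The strict inequality on `q` leaves room for `θ < 1`, needed for fast decay, with `θ r₁ q > (r
  -- + 1) / 2`, needed beyond `N^(θ r₁)`.
  obtain ⟨θ, hθ, hθ1⟩ : ∃ θ, ((r : ℝ) + 1) / (2 * r₁ * q) < θ ∧ θ < 1 := by
    refine exists_between ?_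
    rw [div_lt_iff₀ (by positivity)] at hq ⊢
    linarith
  have hθ0 : 0 < θ := lt_of_le_of_lt (by positivity) hθ
  obtain ⟨K, b, hb, hb0, hbN⟩ := hA4.exists_fast_decay hθ0 hθ1
  have hcomp : IsCompact (Metric.closedBall (0 : ℝ) K ∩ {t | δ ≤ |t|}) :=
    (isCompact_closedBall _ _).inter_right (isClosed_le continuous_const continuous_abs)
  obtain ⟨C, κ, hκ0, hκ1, hCκ⟩ := exists_pow_bound_of_isCompact hcomp hL fun t ht => by
    refine hA3 t fun h0 => ?_
    have : δ ≤ |t| := ht.2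
    rw [h0, abs_zero] at this
    linarith
  set D := ‖l‖ * ‖v‖ with hD
  set T : ℕ → ℝ := fun N => (N : ℝ) ^ (θ * r₁) with hT
  have hφle : ∀ (N : ℕ) (t : ℝ), 1 ≤ N → ‖centeredCharFun P S A N t‖ ≤ D * ‖L t ^ N‖ := by
    intro N t hN
    rw [centeredCharFun_eq, hchar N t hN, norm_mul,
      show -((N : ℂ) * (Complex.I * A * t)) = ((-(N * A * t) : ℝ) : ℂ) * Complex.I by
        push_cast; ring, Complex.norm_exp_ofReal_mul_I, one_mul]
    calc ‖l ((L t ^ N) v)‖ ≤ ‖l‖ * (‖L t ^ N‖ * ‖v‖) :=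
          (l.le_opNorm _).trans (by gcongr; exact ContinuousLinearMap.le_opNorm _ _)
      _ = _ := by ring
  -- The three summands come from the compact range, the range governed by (A4), and the range `|t|
  -- ≥ T N`.
  refine ⟨fun N => 2 * (D * (|C| * κ ^ N + b N) + (T N ^ q)⁻¹), ?_, ?_⟩
  · have h1 := (tendsto_sqrt_pow_mul_pow hκ0 hκ1 (r + 1)).const_mul (2 * D * |C|)
    have h2 : Tendsto (fun N : ℕ => √(N : ℝ) ^ (r + 1) * b N) atTop (𝓝 0) := by
      refine squeeze_zero (fun N => mul_nonneg (by positivity) (hb0 N)) (fun N => ?_) (hb (r + 1))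
      refine mul_le_mul_of_nonneg_right (pow_le_pow_left₀ (Real.sqrt_nonneg _) ?_ _) (hb0 N)
      exact sqrt_natCast_le N
    have h3 : Tendsto (fun N : ℕ => √(N : ℝ) ^ (r + 1) * (T N ^ q)⁻¹) atTop (𝓝 0) := by
      have hpos : 0 < θ * r₁ * q - ((r : ℝ) + 1) / 2 := by
        rw [div_lt_iff₀ (by positivity)] at hθ
        linarith
      refine ((tendsto_rpow_neg_atTop hpos).comp tendsto_natCast_atTop_atTop).congr' ?_
      filter_upwards [eventually_gt_atTop 0] with N hN
      have hN0 : (0 : ℝ) < N := by exact_mod_cast hN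
      simp only [Function.comp_apply, hT]
      rw [Real.sqrt_eq_rpow, ← Real.rpow_natCast, ← Real.rpow_mul hN0.le, ← Real.rpow_natCast,
        ← Real.rpow_mul hN0.le, ← Real.rpow_neg hN0.le, ← Real.rpow_add hN0]
      congr 1
      push_cast
      ring
    have h4 := (h1.add (h2.const_mul (2 * D))).add (h3.const_mul 2)
    simp only [mul_zero, add_zero] at h4
    refine h4.congr fun N => ?_
    ring
  · filter_upwards [hbN, eventually_ge_atTop 1] with N hN hN1 f hf t ht
    have hT1 : 1 ≤ T N := Real.one_le_rpow (by exact_mod_cast hN1) (by positivity)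
    have hC0 : 0 ≤ (mixedNorm (q + 2) (r + 1) f).toReal := ENNReal.toReal_nonneg
    have hD0 : 0 ≤ D := by positivity
    have hbN0 := hb0 N
    have hTq : 0 ≤ (T N ^ q)⁻¹ := by positivity
    have hκN : 0 ≤ |C| * κ ^ N := by positivity
    rcases le_total (T N) |t| with hTt | hTt
    · calc ‖fhat f t‖ * ‖centeredCharFun P S A N t‖
          ≤ 2 * (mixedNorm (q + 2) (r + 1) f).toReal * (1 + t ^ 2)⁻¹ * (T N ^ q)⁻¹ * 1 := by
            gcongr
            · exact norm_fhat_le_of_le_abs hf hT1 hTt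
            · exact norm_centeredCharFun_le P A N t
        _ = (mixedNorm (q + 2) (r + 1) f).toReal * (2 * (0 + (T N ^ q)⁻¹)) * (1 + t ^ 2)⁻¹ := by
            ring
        _ ≤ _ := by
            gcongr
            positivity
    · have hφ2 : ‖centeredCharFun P S A N t‖ ≤ D * (|C| * κ ^ N + b N) := by
        refine (hφle N t hN1).trans ?_
        gcongr
        rcases le_total K |t| with hKt | hKt
        · exact (hN t hKt hTt).trans (by linarith)
        · have := hCκ t ⟨by simpa using hKt, ht⟩ N
          have h5 : C * κ ^ N ≤ |C| * κ ^ N := by gcongr; exact le_abs_self C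
          linarith
      calc ‖fhat f t‖ * ‖centeredCharFun P S A N t‖
          ≤ 2 * (mixedNorm (q + 2) (r + 1) f).toReal * (1 + t ^ 2)⁻¹ *
            (D * (|C| * κ ^ N + b N)) := by
            gcongr
            exact norm_fhat_le hf (by omega) t
        _ = (mixedNorm (q + 2) (r + 1) f).toReal * (2 * (D * (|C| * κ ^ N + b N) + 0)) *
            (1 + t ^ 2)⁻¹ := by ring
        _ ≤ _ := by gcongr

end Conclusion

end Edgeworth

/-! ### The weak local Edgeworth expansion. -/

theorem mainTheorem4
    {Ω : Type*} [MeasurableSpace Ω] (P : Measure Ω) [IsProbabilityMeasure P]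
    (X : ℕ → Ω → ℝ) (hX : ∀ n, Measurable (X n))
    {B : Type*} [NormedAddCommGroup B] [NormedSpace ℂ B] [CompleteSpace B]
    (L : ℝ → B →L[ℂ] B) (v : B) (l : B →L[ℂ] ℂ)
    (hchar : ∀ (N : ℕ) (t : ℝ), 1 ≤ N →
      ∫ ω, Complex.exp (Complex.I * t * Edgeworth.partialSum X N ω) ∂P = l ((L t ^ N) v))
    (r : ℕ) (r₁ : ℝ)
    (hA1 : Edgeworth.AssumptionA1 L (r + 2))
    (hA2 : Edgeworth.AssumptionA2 (L 0))
    (hA3 : Edgeworth.AssumptionA3 L)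
    (hA4 : Edgeworth.AssumptionA4 L r₁)
    (hvar : ∀ (A : ℝ) (σ2 : ℝ≥0),
      Edgeworth.NormalLimit P (Edgeworth.partialSum X) A σ2 → 0 < σ2)
    (q : ℕ) (hq : ((r : ℝ) + 1) / (2 * r₁) < q) :
    ∃ (A : ℝ) (σ2 : ℝ≥0), 0 < σ2 ∧
      Edgeworth.NormalLimit P (Edgeworth.partialSum X) A σ2 ∧
      Edgeworth.WeakLocalEdgeworth P (Edgeworth.partialSum X) A r
        (Edgeworth.functionSpace (q + 2) (r + 1))
        (fun f => (Edgeworth.mixedNorm (q + 2) (r + 1) f).toReal) := by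
  obtain ⟨hLc, d, hd, hLd⟩ := hA1
  have hS : ∀ N, Measurable (Edgeworth.partialSum X N) := fun N =>
    Finset.measurable_fun_sum _ fun n _ => hX n
  have hL0 : ContDiffAt ℝ (r + 2 : ℕ) L 0 :=
    hLd.contDiffAt (Icc_mem_nhds (by linarith) hd)
  obtain ⟨A, c, C, κ, ψ, Z, p, hc, hκ0, hκ1, hψ, hψc, hZ, hclose, hlim⟩ :=
    Edgeworth.exists_local_form P hchar hL0 hA2
  have hNL := Edgeworth.normalLimit_of_tendsto_charFun P hS hc hlim
  have hσ := hvar _ _ hNL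
  -- Non-degeneracy applied to the normal limit just found, whose variance is `2 c`.
  have hc0 : 0 < c := by
    rw [Real.toNNReal_pos] at hσ
    linarith
  refine ⟨A, _, hσ, hNL, ?_⟩
  have hZc : ∀ᶠ t in 𝓝 (0 : ℝ), ContinuousAt Z t :=
    ((hZ.of_le (m := 0) (by simp)).eventually (by simp)).mono fun t ht => ht.continuousAt
  have hZb : ∀ᶠ t in 𝓝 (0 : ℝ), ‖Z t‖ < ‖Z 0‖ + 1 :=
    hZ.continuousAt.norm.eventually (gt_mem_nhds (lt_add_one _))
  have hψb : ∀ᶠ t in 𝓝 (0 : ℝ), ‖ψ t‖ ≤ c / 2 * t ^ 2 := by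
    have h := (Edgeworth.isLittleO_pow_mul_sub (G := fun _ => 0) (g := 0) hψ (by simp) 0).2.2.2
    filter_upwards [h.bound (half_pos hc0)] with t ht
    simpa using ht
  -- The amplitude is needed only to order `r`; the two extra derivatives are spent on the phase,
  -- which is multiplied by `N`.
  obtain ⟨a, -, ha⟩ := Edgeworth.exists_taylor_isLittleO
    (hZ.of_le (m := (r : ℕ)) (by exact_mod_cast Nat.le_add_right r 2))
  have hlap : ∀ k ∈ Finset.range (r + 1), ∀ᶠ δ in 𝓝[>] (0 : ℝ), Edgeworth.HasExpansion r fun N =>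
      ((√(N : ℝ) : ℝ) : ℂ) * ∫ t in -δ..δ, ((t : ℂ) ^ k * Z t) *
        Complex.exp (N * (-c * (t : ℂ) ^ 2 + ψ t)) := by
    intro k _
    refine Edgeworth.hasExpansion_laplace hc0 (p := p) (g := Polynomial.X ^ k *
      ∑ j ∈ Finset.range (r + 1), Polynomial.C (a j) * Polynomial.X ^ j) hψ ?_ hψc ?_
    · have h1 := Edgeworth.isBigO_pow_mul_eval k 1
      have h2 := h1.mul_isLittleO ha
      refine ((h2.congr_right fun t => (pow_add t k r).symm).trans_isBigO
        (Edgeworth.isBigO_pow_of_le (Nat.le_add_left r k))).congr_left fun t => ?_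
      simp only [Polynomial.eval_one, Polynomial.eval_mul, Polynomial.eval_pow, Polynomial.eval_X,
        Polynomial.eval_finsetSum, Polynomial.eval_C]
      ring
    · filter_upwards [hZc] with t ht
      have : Continuous fun t : ℝ => (t : ℂ) ^ k := by fun_prop
      exact this.continuousAt.mul ht
  obtain ⟨ε, hε, hball⟩ := Metric.eventually_nhds_iff.1
    (hclose.and (hψc.and (hZc.and (hZb.and hψb))))
  -- One `δ` serves all `k ≤ r` at once because Laplace's method holds for every sufficiently small
  -- `δ`.
  obtain ⟨δ, hδlap, hδ0, hδε⟩ := (((Finset.eventually_all _).2 hlap).and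
    (Ioo_mem_nhdsGT hε)).exists
  have hnear : ∀ t : ℝ, |t| ≤ δ → _ := fun t ht =>
    hball (y := t) (by rw [dist_zero_right, Real.norm_eq_abs]; exact ht.trans_lt hδε)
  have hφc := Edgeworth.continuous_centeredCharFun P A hS
  obtain ⟨b, hb, hbN⟩ := Edgeworth.exists_high_frequency_bound P (r := r) hchar hLc hA3 hA4 hq A hδ0
  refine Edgeworth.weakLocalEdgeworth_of_expansion P A hS hδ0 (fun k hk => ?_) ?_ hb hbN
  · refine Edgeworth.HasExpansion.integral_of_close hφc hκ0 hκ1 hδ0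
      (Φ := fun N t => Z t * Complex.exp (N * (-c * (t : ℂ) ^ 2 + ψ t))) (fun N t ht => ?_)
      (fun t ht N hN => (hnear t ht).1 N hN) ?_
    · obtain ⟨-, h1, h2, -⟩ := hnear t (abs_le.2 ht)
      have h3 : Continuous fun t : ℝ => -(c : ℂ) * (t : ℂ) ^ 2 := by fun_prop
      exact (h2.mul (continuousAt_const.mul (h3.continuousAt.add h1)).cexp).continuousWithinAt
    · simpa only [mul_assoc] using hδlap k (Finset.mem_range.2 (by omega))
  -- Half of the Gaussian exponent is given up to absorb `|ψ t| ≤ c t² / 2`.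
  · refine Edgeworth.tendsto_remainder_integral hφc (M := ‖Z 0‖ + 1) (C := C) (half_pos hc0)
      hκ0 hκ1 hδ0 r fun t ht N hN => ?_
    obtain ⟨h1, -, -, h2, h3⟩ := hnear t ht
    have h4 : ‖Complex.exp (N * (-c * (t : ℂ) ^ 2 + ψ t))‖ ≤
        Real.exp (-(c / 2) * (√(N : ℝ) * t) ^ 2) := by
      rw [Complex.norm_exp, Real.exp_le_exp, mul_pow, Real.sq_sqrt (Nat.cast_nonneg N)]
      have h5 := (Complex.abs_re_le_norm (ψ t)).trans h3
      have h6 := (abs_le.1 h5).2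
      have h7 : ((N : ℂ) * (-c * (t : ℂ) ^ 2 + ψ t)).re = N * (-c * t ^ 2 + (ψ t).re) := by
        rw [← Complex.ofReal_natCast, Complex.re_ofReal_mul, Complex.add_re,
          ← Complex.ofReal_neg, ← Complex.ofReal_pow, ← Complex.ofReal_mul, Complex.ofReal_re]
      rw [h7]
      calc (N : ℝ) * (-c * t ^ 2 + (ψ t).re) ≤ N * (-c * t ^ 2 + c / 2 * t ^ 2) := by gcongr
        _ = _ := by ring
    have h8 := norm_sub_norm_le (Edgeworth.centeredCharFun P (Edgeworth.partialSum X) A N t)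
      (Z t * Complex.exp (N * (-c * (t : ℂ) ^ 2 + ψ t)))
    have h9 := h1 N hN
    have h10 : ‖Z t * Complex.exp (N * (-c * (t : ℂ) ^ 2 + ψ t))‖ ≤
        (‖Z 0‖ + 1) * Real.exp (-(c / 2) * (√(N : ℝ) * t) ^ 2) := by
      rw [norm_mul]
      exact mul_le_mul h2.le h4 (norm_nonneg _) (by positivity)
    linarith
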